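/- **Theorem.** Let $M>0$. Let $\rho_1,\sigma_1\in H^2(-1,0)$, $q_1\in C([-1,0])$, $\rho_2,\sigma_2\in H^2(0,1)$, $q_2\in C([0,1])$ be real-valued and positive on the closed intervals $[-1,0]$ and $[0,1]$ respectively (where $H^2$ functions are identified with their $C^1$ representatives). Consider the spectral problem with a point mass $M$ at $x=0$: find $\lambda\in\mathbb{R}$ and $(u,v)\neq(0,0)$, $u\in H^2(-1,0)$, $v\in H^2(0,1)$ real-valued, with $$\begin{cases}-(\sigma_1u')'+q_1u=\lambda\rho_1u & \text{a.e. on }(-1,0),\\ -(\sigma_2v')'+q_2v=\lambda\rho_2v & \text{a.e. on }(0,1),\\ u(-1)=v(1)=0,\quad u(0)=v(0),\\ \sigma_1(0)u'(0)-\sigma_2(0)v'(0)=\lambda M u(0).\end{cases}$$ Then the eigenvalues of this problem are all simple (one-dimensional eigenspaces) and form an infinite strictly increasing sequence $\lambda_1<\lambda_2<\cdots$, and there is a constant $\delta_1>0$ (depending only on $M$ and the coefficients) such that $$\lambda_{n+1}-\lambda_n\ge\delta_1\qquad\text{for all } n\ge 1 .$$ -/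

import Mathlib

open Set MeasureTheory

/-- The Sobolev space `H¹(a, b)` on a bounded interval (`a < b`), each class being represented by
its continuous representative on `[a, b]`: the absolutely continuous functions on `[a, b]` whose
(almost everywhere defined) derivative is square integrable. -/
def MemH1 (a b : ℝ) (f : ℝ → ℝ) : Prop :=
  AbsolutelyContinuousOnInterval f a b ∧ MemLp (deriv f) 2 (volume.restrict (Ioo a b))

/-- The Sobolev space `H²(a, b)` on a bounded interval (`a < b`), each class being represented by
its continuously differentiable representative on `[a, b]`: the functions that are differentiable
on `[a, b]` (one-sidedly at the end points) with derivative in `H¹(a, b)`. -/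
def MemH2 (a b : ℝ) (f : ℝ → ℝ) : Prop :=
  DifferentiableOn ℝ f (Icc a b) ∧ MemH1 a b (derivWithin f (Icc a b))

/-- Admissible coefficients on one rod `[a, b]`: density `ρ` and conductivity `σ` in `H²(a, b)`,
potential `q` in `C([a, b])`, all three positive on the compact interval `[a, b]`
(hence uniformly positive, being continuous there). -/
structure IsRod (a b : ℝ) (ρ σ q : ℝ → ℝ) : Prop where
  memH2_density : MemH2 a b ρ
  memH2_conductivity : MemH2 a b σ
  continuous_potential : ContinuousOn q (Icc a b)
  density_pos : ∀ x ∈ Icc a b, 0 < ρ x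
  conductivity_pos : ∀ x ∈ Icc a b, 0 < σ x
  potential_pos : ∀ x ∈ Icc a b, 0 < q x

/-- `y ∈ H²(a, b)` solves `-(σ y')' + q y = lam ρ y` almost everywhere on `(a, b)`. -/
def SolvesSL (a b : ℝ) (ρ σ q : ℝ → ℝ) (lam : ℝ) (y : ℝ → ℝ) : Prop :=
  MemH2 a b y ∧
    ∀ᵐ x ∂(volume.restrict (Ioo a b)),
      -deriv (fun t => σ t * derivWithin y (Icc a b) t) x + q x * y x = lam * ρ x * y x

/-- `(u, v)`, with `u` on `[-1, 0]` and `v` on `[0, 1]`, is a solution (possibly zero) of the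
Dirichlet spectral problem with a point mass `M` at `x = 0` and spectral parameter `lam`. -/
structure SolvesPointMass (ρ₁ σ₁ q₁ ρ₂ σ₂ q₂ : ℝ → ℝ) (M lam : ℝ) (u v : ℝ → ℝ) : Prop where
  left : SolvesSL (-1) 0 ρ₁ σ₁ q₁ lam u
  right : SolvesSL 0 1 ρ₂ σ₂ q₂ lam v
  dirichlet_left : u (-1) = 0
  dirichlet_right : v 1 = 0
  continuity : u 0 = v 0
  mass : σ₁ 0 * derivWithin u (Icc (-1) 0) 0 - σ₂ 0 * derivWithin v (Icc 0 1) 0 = lam * M * u 0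

/-- The pair `(u, v)` is not the zero function on `[-1, 0]`, `[0, 1]`. -/
def NonzeroPair (u v : ℝ → ℝ) : Prop :=
  (∃ x ∈ Icc (-1 : ℝ) 0, u x ≠ 0) ∨ (∃ x ∈ Icc (0 : ℝ) 1, v x ≠ 0)

/-- The set of (real) eigenvalues of the Dirichlet spectral problem with a point mass. -/
def pointMassEigenvalues (ρ₁ σ₁ q₁ ρ₂ σ₂ q₂ : ℝ → ℝ) (M : ℝ) : Set ℝ :=
  {lam | ∃ u v : ℝ → ℝ, SolvesPointMass ρ₁ σ₁ q₁ ρ₂ σ₂ q₂ M lam u v ∧ NonzeroPair u v}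

/-- `lam` is a simple eigenvalue: an eigenvalue such that every solution of the spectral problem is
a scalar multiple of every eigenfunction. -/
def IsSimplePointMassEigenvalue (ρ₁ σ₁ q₁ ρ₂ σ₂ q₂ : ℝ → ℝ) (M lam : ℝ) : Prop :=
  lam ∈ pointMassEigenvalues ρ₁ σ₁ q₁ ρ₂ σ₂ q₂ M ∧
    ∀ u v u' v' : ℝ → ℝ,
      SolvesPointMass ρ₁ σ₁ q₁ ρ₂ σ₂ q₂ M lam u v → NonzeroPair u v →
      SolvesPointMass ρ₁ σ₁ q₁ ρ₂ σ₂ q₂ M lam u' v' →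
      ∃ c : ℝ, (∀ x ∈ Icc (-1 : ℝ) 0, u' x = c * u x) ∧ (∀ x ∈ Icc (0 : ℝ) 1, v' x = c * v x)

/-!
Both rods are parametrised by `[0, 1]` from the clamped end towards the mass, and the equation is
written as the first-order system `y' = α p`, `p' = (q - lam ρ) y` for the displacement and the flux
(`IsSol`); an absolutely continuous flux whose derivative is almost everywhere continuous is
continuously differentiable, so the `H²` problem and the classical one agree.

Attach half of the mass to each rod. At a scale `K > 0`, the vector with coordinates `y` and
`(p - lam (M / 2) y) / K` at the loaded end, for the solution clamped at the other end, has a polar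
angle `Θ lam`, a *phase* of the rod (`IsPhase`). It is the end value of Prüfer equations, whose
comparison theorem makes it continuous and strictly increasing in `lam`. The matching conditions at
the mass say that the vectors of the two rods are mirror images of each other up to a factor, that
is, `Θ₁ lam + Θ₂ lam ∈ π ℤ` (`mem_pairSpectrum_iff`). Simplicity of the eigenvalues is visible from
the same description. For `lam ≤ 0` the product `y p` is nondecreasing, which makes all eigenvalues
positive. At `lam = 0` the phases are at most `π / 2`, and at `lam = K²` they are of order `K`, so
by the intermediate value theorem there are infinitely many eigenvalues (`infinite_pairSpectrum`).

For the gap, take an eigenvalue `lam` and the scale `K = lam + 1`. The sine of the increment of a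
phase is a normalised Wronskian, that is, the increment of `lam` times an integral of `ρ y z` plus
a mass term. The energy `K ρ y² + α p²` varies along the rod by a factor bounded uniformly in `K`
(`IsUnitRod.exists_energy_bound`, which uses that `ρ` and `α` are continuously differentiable), and
the weight that the mass gives to `y` at the end matches the scale `K`. Hence the phases are
Lipschitz on `[lam, lam + 1]` with a constant independent of `lam`
(`IsUnitRod.exists_phase_lipschitz`). Up to the next eigenvalue `Θ₁ + Θ₂` has to grow by at least
`π`, which takes a fixed amount of `lam` (`exists_gap_pairSpectrum`).
-/

/-! ### Calculus on the unit interval -/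

theorem hasDerivWithinAt_integral_of_continuousOn {a b : ℝ} (hab : a ≤ b) {g : ℝ → ℝ}
    (hg : ContinuousOn g (Icc a b)) {t : ℝ} (ht : t ∈ Icc a b) :
    HasDerivWithinAt (fun x => ∫ s in a..x, g s) (g t) (Icc a b) t := by
  have hc : Continuous (IccExtend hab ((Icc a b).domRestrict g)) :=
    (continuousOn_iff_continuous_domRestrict.mp hg).Icc_extend'
  have heq : ∀ x ∈ Icc a b, ∫ s in a..x, g s
      = ∫ s in a..x, IccExtend hab ((Icc a b).domRestrict g) s := fun x hx =>
    intervalIntegral.integral_congr fun s hs => by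
      rw [uIcc_of_le hx.1] at hs
      rw [IccExtend_of_mem _ _ ⟨hs.1, hs.2.trans hx.2⟩]
      rfl
  have h := (hc.integral_hasStrictDerivAt a t).hasDerivAt.hasDerivWithinAt (s := Icc a b)
  rw [IccExtend_of_mem _ _ ht] at h
  exact h.congr heq (heq t ht)

theorem exists_primitive_unit {g : ℝ → ℝ} (hg : ContinuousOn g (Icc 0 1)) :
    ∃ G : ℝ → ℝ, G 0 = 0 ∧ ∀ t ∈ Icc (0 : ℝ) 1, HasDerivWithinAt G (g t) (Icc 0 1) t :=
  ⟨fun t => ∫ s in (0 : ℝ)..t, g s, by simp, fun _ ht =>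
    hasDerivWithinAt_integral_of_continuousOn zero_le_one hg ht⟩

theorem monotoneOn_unit_of_hasDerivWithinAt {f f' : ℝ → ℝ}
    (hf : ∀ t ∈ Icc (0 : ℝ) 1, HasDerivWithinAt f (f' t) (Icc 0 1) t)
    (hf' : ∀ t ∈ Icc (0 : ℝ) 1, 0 ≤ f' t) : MonotoneOn f (Icc 0 1) := by
  have hd : ∀ t ∈ interior (Icc (0 : ℝ) 1), HasDerivAt f (f' t) t := fun t ht =>
    (hf t (interior_subset ht)).hasDerivAt (mem_interior_iff_mem_nhds.mp ht)
  refine monotoneOn_of_deriv_nonneg (convex_Icc 0 1) (fun t ht => (hf t ht).continuousWithinAt)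
    (fun t ht => (hd t ht).differentiableAt.differentiableWithinAt) fun t ht => ?_
  rw [(hd t ht).deriv]
  exact hf' t (interior_subset ht)

theorem hasDerivWithinAt_unit_unique {f : ℝ → ℝ} {a b t : ℝ} (ht : t ∈ Icc (0 : ℝ) 1)
    (ha : HasDerivWithinAt f a (Icc 0 1) t) (hb : HasDerivWithinAt f b (Icc 0 1) t) : a = b :=
  (uniqueDiffOn_Icc zero_lt_one t ht).eq_deriv _ ha hb

theorem hasDerivWithinAt_unit_Ici {f : ℝ → ℝ} {a t : ℝ} (ht : t ∈ Ico (0 : ℝ) 1)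
    (h : HasDerivWithinAt f a (Icc 0 1) t) : HasDerivWithinAt f a (Ici t) t :=
  h.mono_of_mem_nhdsWithin <| Filter.mem_of_superset (Icc_mem_nhdsGE ht.2)
    (Icc_subset_Icc_left ht.1)

/-! ### The Prüfer equation -/

/-- `θ` solves the Prüfer equation `θ' = A cos² θ + B sin² θ` on `[0, 1]`. -/
def IsPrufer (A B θ : ℝ → ℝ) : Prop :=
  ∀ t ∈ Icc (0 : ℝ) 1,
    HasDerivWithinAt θ (A t * Real.cos (θ t) ^ 2 + B t * Real.sin (θ t) ^ 2) (Icc 0 1) t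

theorem Real.sin_sq_sub_sin_sq (x y : ℝ) :
    Real.sin x ^ 2 - Real.sin y ^ 2 = Real.sin (x + y) * Real.sin (x - y) := by
  rw [Real.sin_add, Real.sin_sub]
  linear_combination Real.sin y ^ 2 * Real.sin_sq_add_cos_sq x
    - Real.sin x ^ 2 * Real.sin_sq_add_cos_sq y

theorem Real.abs_sin_sq_sub_sin_sq_le (x y : ℝ) :
    |Real.sin x ^ 2 - Real.sin y ^ 2| ≤ |x - y| := by
  rw [Real.sin_sq_sub_sin_sq, abs_mul]
  calc |Real.sin (x + y)| * |Real.sin (x - y)| ≤ 1 * |x - y| :=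
        mul_le_mul (Real.abs_sin_le_one _) Real.abs_sin_le_abs (abs_nonneg _) zero_le_one
    _ = |x - y| := one_mul _

/-- The right-hand side of the Prüfer equation is bounded and globally Lipschitz in `θ`, so that
the Picard–Lindelöf theorem gives a solution on the whole interval. -/
theorem exists_isPrufer {A B : ℝ → ℝ} (hA : ContinuousOn A (Icc 0 1))
    (hB : ContinuousOn B (Icc 0 1)) (x : ℝ) : ∃ θ, θ 0 = x ∧ IsPrufer A B θ := by
  obtain ⟨CA, hCA⟩ := isCompact_Icc.exists_bound_of_continuousOn hA
  obtain ⟨CB, hCB⟩ := isCompact_Icc.exists_bound_of_continuousOn hB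
  have h0 : (0 : ℝ) ∈ Icc (0 : ℝ) 1 := ⟨le_rfl, zero_le_one⟩
  have hCA0 : 0 ≤ CA := (norm_nonneg _).trans (hCA 0 h0)
  have hCB0 : 0 ≤ CB := (norm_nonneg _).trans (hCB 0 h0)
  let L : NNReal := ⟨CA + CB, by positivity⟩
  have hpl : IsPicardLindelof (fun t s => A t * Real.cos s ^ 2 + B t * Real.sin s ^ 2)
      (⟨0, h0⟩ : Icc (0 : ℝ) 1) x L 0 L L := by
    refine ⟨fun t ht => ?_, fun s _ => ?_, fun t ht s _ => ?_, ?_⟩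
    · refine LipschitzOnWith.of_dist_le_mul fun s _ r _ => ?_
      rw [Real.dist_eq, Real.dist_eq]
      have e : A t * Real.cos s ^ 2 + B t * Real.sin s ^ 2
          - (A t * Real.cos r ^ 2 + B t * Real.sin r ^ 2)
          = (B t - A t) * (Real.sin s ^ 2 - Real.sin r ^ 2) := by
        rw [Real.cos_sq', Real.cos_sq']; ring
      rw [e, abs_mul]
      have h1 : |B t - A t| ≤ CA + CB := by
        have := hCA t ht
        have := hCB t ht
        simp only [Real.norm_eq_abs] at *
        linarith [abs_sub (B t) (A t)]
      exact mul_le_mul h1 (Real.abs_sin_sq_sub_sin_sq_le s r) (abs_nonneg _) (by positivity)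
    · exact (hA.mul continuousOn_const).add (hB.mul continuousOn_const)
    · have h1 : |A t| ≤ CA := hCA t ht
      have h2 : |B t| ≤ CB := hCB t ht
      have h3 : ‖A t * Real.cos s ^ 2 + B t * Real.sin s ^ 2‖ ≤ CA * 1 + CB * 1 := by
        rw [Real.norm_eq_abs]
        refine (abs_add_le _ _).trans (add_le_add ?_ ?_)
        · rw [abs_mul, abs_of_nonneg (sq_nonneg (Real.cos s))]
          exact mul_le_mul h1 (Real.cos_sq_le_one s) (sq_nonneg _) hCA0
        · rw [abs_mul, abs_of_nonneg (sq_nonneg (Real.sin s))]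
          exact mul_le_mul h2 (Real.sin_sq_le_one s) (sq_nonneg _) hCB0
      exact h3.trans_eq (by rw [mul_one, mul_one]; rfl)
    · simp
  obtain ⟨θ, hθ0, hθ⟩ := hpl.exists_eq_forall_mem_Icc_hasDerivWithinAt₀
  exact ⟨θ, hθ0, hθ⟩

namespace IsPrufer

variable {A B A' B' θ θ' : ℝ → ℝ}

theorem continuousOn (h : IsPrufer A B θ) : ContinuousOn θ (Icc 0 1) :=
  fun t ht => (h t ht).continuousWithinAt

/-- The difference of two angles satisfies a linear equation `d' = c d + g` with `c` continuous
and with `g ≥ 0` if the coefficients are ordered, so it is increasing up to an integrating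
factor. -/
theorem exists_pos_monotoneOn (hB' : ContinuousOn B' (Icc 0 1))
    (hA' : ContinuousOn A' (Icc 0 1))
    (h : IsPrufer A B θ) (h' : IsPrufer A' B' θ') (hAA : ∀ t ∈ Icc (0 : ℝ) 1, A t ≤ A' t)
    (hBB : ∀ t ∈ Icc (0 : ℝ) 1, B t ≤ B' t) :
    ∃ e : ℝ → ℝ, (∀ t, 0 < e t) ∧ MonotoneOn (fun t => e t * (θ' t - θ t)) (Icc 0 1) := by
  have hc : ContinuousOn (fun t => (B' t - A' t) * Real.sin (θ' t + θ t)
      * Real.sinc (θ' t - θ t)) (Icc 0 1) :=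
    ((hB'.sub hA').mul (Real.continuous_sin.comp_continuousOn
      (h'.continuousOn.add h.continuousOn))).mul
      (Real.continuous_sinc.comp_continuousOn (h'.continuousOn.sub h.continuousOn))
  obtain ⟨G, -, hG⟩ := exists_primitive_unit hc
  refine ⟨fun t => Real.exp (-G t), fun t => Real.exp_pos _, ?_⟩
  refine monotoneOn_unit_of_hasDerivWithinAt
    (f' := fun t => Real.exp (-G t) * ((A' t - A t) * Real.cos (θ t) ^ 2
      + (B' t - B t) * Real.sin (θ t) ^ 2)) (fun t ht => ?_) (fun t ht => ?_)
  · have h1 := ((hG t ht).neg.exp).mul ((h' t ht).sub (h t ht))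
    refine h1.congr_deriv ?_
    have hs : Real.sinc (θ' t - θ t) * (θ' t - θ t) = Real.sin (θ' t - θ t) := by
      by_cases hd : θ' t - θ t = 0
      · simp [hd]
      · rw [Real.sinc_of_ne_zero hd, div_mul_cancel₀ _ hd]
    have h2 := Real.sin_sq_sub_sin_sq (θ' t) (θ t)
    simp only [Pi.neg_apply, Pi.sub_apply]
    rw [Real.cos_sq' (θ t), Real.cos_sq' (θ' t)]
    linear_combination (-Real.exp (-G t) * (B' t - A' t) * Real.sin (θ' t + θ t)) * hs
      + Real.exp (-G t) * (B' t - A' t) * h2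
  · have := hAA t ht
    have := hBB t ht
    have h1 : 0 ≤ (A' t - A t) * Real.cos (θ t) ^ 2 := mul_nonneg (by linarith) (sq_nonneg _)
    have h2 : 0 ≤ (B' t - B t) * Real.sin (θ t) ^ 2 := mul_nonneg (by linarith) (sq_nonneg _)
    have := Real.exp_pos (-G t)
    positivity

/-- Comparison of angles. -/
theorem le_of_le (hB' : ContinuousOn B' (Icc 0 1))
    (hA' : ContinuousOn A' (Icc 0 1))
    (h : IsPrufer A B θ) (h' : IsPrufer A' B' θ') (hAA : ∀ t ∈ Icc (0 : ℝ) 1, A t ≤ A' t)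
    (hBB : ∀ t ∈ Icc (0 : ℝ) 1, B t ≤ B' t) (h0 : θ 0 ≤ θ' 0) : θ 1 ≤ θ' 1 := by
  obtain ⟨e, he, hm⟩ := h.exists_pos_monotoneOn hB' hA' h' hAA hBB
  have h1 := hm (left_mem_Icc.mpr zero_le_one) (right_mem_Icc.mpr zero_le_one) zero_le_one
  have h2 : 0 ≤ e 0 * (θ' 0 - θ 0) := mul_nonneg (he 0).le (sub_nonneg.mpr h0)
  exact sub_nonneg.mp (nonneg_of_mul_nonneg_right (h2.trans h1) (he 1))

theorem lt_of_lt (hB' : ContinuousOn B' (Icc 0 1))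
    (hA' : ContinuousOn A' (Icc 0 1))
    (h : IsPrufer A B θ) (h' : IsPrufer A' B' θ') (hAA : ∀ t ∈ Icc (0 : ℝ) 1, A t ≤ A' t)
    (hBB : ∀ t ∈ Icc (0 : ℝ) 1, B t ≤ B' t) (h0 : θ 0 < θ' 0) : θ 1 < θ' 1 := by
  obtain ⟨e, he, hm⟩ := h.exists_pos_monotoneOn hB' hA' h' hAA hBB
  have h1 := hm (left_mem_Icc.mpr zero_le_one) (right_mem_Icc.mpr zero_le_one) zero_le_one
  have h2 : 0 < e 0 * (θ' 0 - θ 0) := mul_pos (he 0) (sub_pos.mpr h0)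
  exact sub_pos.mp (pos_of_mul_pos_right (h2.trans_le h1) (he 1).le)

/-- Strict comparison: equality at `1` forces the two angles to agree, hence `sin θ = 0`
throughout, which `A > 0` excludes. -/
theorem lt_of_coeff_lt (hA : ContinuousOn A (Icc 0 1)) (hB' : ContinuousOn B' (Icc 0 1))
    (h : IsPrufer A B θ) (h' : IsPrufer A B' θ') (hA0 : 0 < A 0)
    (hBB : ∀ t ∈ Icc (0 : ℝ) 1, B t < B' t) (h0 : θ 0 = θ' 0) : θ 1 < θ' 1 := by
  obtain ⟨e, he, hm⟩ := h.exists_pos_monotoneOn hB' hA h' (fun _ _ => le_rfl)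
    (fun t ht => (hBB t ht).le)
  have hle := h.le_of_le hB' hA h' (fun _ _ => le_rfl) (fun t ht => (hBB t ht).le) h0.le
  refine lt_of_le_of_ne hle fun h1 => ?_
  have hm0 : (0 : ℝ) ∈ Icc (0 : ℝ) 1 := left_mem_Icc.mpr zero_le_one
  have hm1 : (1 : ℝ) ∈ Icc (0 : ℝ) 1 := right_mem_Icc.mpr zero_le_one
  have heq : ∀ t ∈ Icc (0 : ℝ) 1, θ t = θ' t := fun t ht => by
    have a := hm hm0 ht ht.1
    have b := hm ht hm1 ht.2
    simp only [h0, h1, sub_self, mul_zero] at a b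
    have := (mul_eq_zero.mp (le_antisymm b a)).resolve_left (he t).ne'
    linarith
  have hsin : ∀ t ∈ Icc (0 : ℝ) 1, Real.sin (θ t) = 0 := fun t ht => by
    have a := hasDerivWithinAt_unit_unique ht (h t ht) ((h' t ht).congr heq (heq t ht))
    rw [← heq t ht] at a
    have b : (B' t - B t) * Real.sin (θ t) ^ 2 = 0 := by linarith
    exact pow_eq_zero_iff two_ne_zero |>.mp
      ((mul_eq_zero.mp b).resolve_left (sub_pos.mpr (hBB t ht)).ne')
  have hd := hasDerivWithinAt_unit_unique hm0 ((h 0 hm0).sin)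
    ((hasDerivWithinAt_const (0 : ℝ) (Icc (0 : ℝ) 1) (0 : ℝ)).congr hsin (hsin 0 hm0))
  have hs := hsin 0 hm0
  have hcs := Real.sin_sq_add_cos_sq (θ 0)
  rw [hs] at hd hcs
  have hcos : Real.cos (θ 0) ≠ 0 := fun hc => by simp [hc] at hcs
  have : Real.cos (θ 0) ^ 2 * Real.cos (θ 0) * A 0 = 0 := by linear_combination hd
  simp [hcos, hA0.ne'] at this

/-- Lipschitz dependence of the angle on its initial value and on the coefficient `B`. -/
theorem abs_sub_le {C δ : ℝ} (hC : 1 ≤ C) (hAC : ∀ t ∈ Icc (0 : ℝ) 1, |A t| ≤ C)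
    (hBC : ∀ t ∈ Icc (0 : ℝ) 1, |B t| ≤ C) (hδ : 0 ≤ δ)
    (hBB : ∀ t ∈ Icc (0 : ℝ) 1, |B' t - B t| ≤ δ)
    (h : IsPrufer A B θ) (h' : IsPrufer A B' θ') :
    |θ' 1 - θ 1| ≤ (|θ' 0 - θ 0| + δ) * Real.exp (2 * C) := by
  have key := norm_le_gronwallBound_of_norm_deriv_right_le (f := fun t => θ' t - θ t)
    (f' := fun t => (A t * Real.cos (θ' t) ^ 2 + B' t * Real.sin (θ' t) ^ 2)
      - (A t * Real.cos (θ t) ^ 2 + B t * Real.sin (θ t) ^ 2)) (a := 0) (b := 1)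
    (δ := |θ' 0 - θ 0|) (K := 2 * C) (ε := δ)
    (h'.continuousOn.sub h.continuousOn)
    (fun t ht => hasDerivWithinAt_unit_Ici ht
      ((h' t (Ico_subset_Icc_self ht)).sub (h t (Ico_subset_Icc_self ht))))
    (by simp) (fun t ht => ?_) 1 (right_mem_Icc.mpr zero_le_one)
  · rw [gronwallBound_of_K_ne_0 (by positivity)] at key
    simp only [sub_zero, mul_one, Real.norm_eq_abs] at key
    have he : 1 ≤ Real.exp (2 * C) := Real.one_le_exp (by positivity)
    have h1 : δ / (2 * C) ≤ δ := div_le_self hδ (by linarith)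
    have h2 : δ / (2 * C) * (Real.exp (2 * C) - 1) ≤ δ * Real.exp (2 * C) :=
      mul_le_mul h1 (by linarith) (by linarith) hδ
    linarith
  · have ht := Ico_subset_Icc_self ht
    have e : A t * Real.cos (θ' t) ^ 2 + B' t * Real.sin (θ' t) ^ 2
        - (A t * Real.cos (θ t) ^ 2 + B t * Real.sin (θ t) ^ 2)
        = (B t - A t) * (Real.sin (θ' t) ^ 2 - Real.sin (θ t) ^ 2)
          + (B' t - B t) * Real.sin (θ' t) ^ 2 := by
      rw [Real.cos_sq', Real.cos_sq']; ring
    rw [e, Real.norm_eq_abs, Real.norm_eq_abs]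
    refine (abs_add_le _ _).trans (add_le_add ?_ ?_)
    · rw [abs_mul]
      have h1 : |B t - A t| ≤ 2 * C := by
        linarith [abs_sub (B t) (A t), hAC t ht, hBC t ht]
      exact mul_le_mul h1 (Real.abs_sin_sq_sub_sin_sq_le _ _) (abs_nonneg _) (by positivity)
    · rw [abs_mul, abs_of_nonneg (sq_nonneg (Real.sin (θ' t)))]
      calc _ ≤ δ * 1 := mul_le_mul (hBB t ht) (Real.sin_sq_le_one _) (sq_nonneg _) hδ
        _ = δ := mul_one δ

end IsPrufer

/-! ### The first-order system on the unit interval -/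

/-- `(y, p)` solves the first-order form `y' = α p`, `p' = (q - lam ρ) y` of a Sturm–Liouville
equation on `[0, 1]`; here `α` is the reciprocal of the conductivity and `p` is the flux. -/
def IsSol (α ρ q : ℝ → ℝ) (lam : ℝ) (y p : ℝ → ℝ) : Prop :=
  ∀ t ∈ Icc (0 : ℝ) 1, HasDerivWithinAt y (α t * p t) (Icc 0 1) t ∧
    HasDerivWithinAt p ((q t - lam * ρ t) * y t) (Icc 0 1) t

/-- Passage from the Prüfer angle back to the linear system: the amplitude `R` solves a linear
first-order equation. -/
theorem IsPrufer.exists_isSol {α ρ q θ : ℝ → ℝ} {lam K : ℝ} (hK : 0 < K)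
    (hα : ContinuousOn α (Icc 0 1)) (hρ : ContinuousOn ρ (Icc 0 1)) (hq : ContinuousOn q (Icc 0 1))
    (h : IsPrufer (fun t => K * α t) (fun t => (lam * ρ t - q t) / K) θ) :
    ∃ R : ℝ → ℝ, (∀ t, 0 < R t) ∧
      IsSol α ρ q lam (fun t => R t * Real.sin (θ t)) (fun t => K * (R t * Real.cos (θ t))) := by
  have hc : ContinuousOn (fun t => (K * α t - (lam * ρ t - q t) / K) *
      (Real.sin (θ t) * Real.cos (θ t))) (Icc 0 1) :=
    ((continuousOn_const.mul hα).sub (((continuousOn_const.mul hρ).sub hq).div_const K)).mul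
      ((Real.continuous_sin.comp_continuousOn h.continuousOn).mul
        (Real.continuous_cos.comp_continuousOn h.continuousOn))
  obtain ⟨G, -, hG⟩ := exists_primitive_unit hc
  refine ⟨fun t => Real.exp (G t), fun t => Real.exp_pos _, fun t ht => ⟨?_, ?_⟩⟩
  · refine ((hG t ht).exp.mul (h t ht).sin).congr_deriv ?_
    have hcs := Real.sin_sq_add_cos_sq (θ t)
    field_simp
    linear_combination (K ^ 2 * α t * Real.cos (θ t)) * hcs
  · refine (((hG t ht).exp.mul (h t ht).cos).const_mul K).congr_deriv ?_
    have hcs := Real.sin_sq_add_cos_sq (θ t)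
    field_simp
    linear_combination ((q t - lam * ρ t) * Real.sin (θ t)) * hcs

namespace IsSol

variable {α ρ q y p z r : ℝ → ℝ} {lam mu : ℝ}

theorem continuousOn_fst (h : IsSol α ρ q lam y p) : ContinuousOn y (Icc 0 1) :=
  fun t ht => (h t ht).1.continuousWithinAt

theorem continuousOn_snd (h : IsSol α ρ q lam y p) : ContinuousOn p (Icc 0 1) :=
  fun t ht => (h t ht).2.continuousWithinAt

theorem const_mul (c : ℝ) (h : IsSol α ρ q lam y p) :
    IsSol α ρ q lam (fun t => c * y t) (fun t => c * p t) := fun t ht =>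
  ⟨((h t ht).1.const_mul c).congr_deriv (by ring), ((h t ht).2.const_mul c).congr_deriv (by ring)⟩

theorem sub (h : IsSol α ρ q lam y p) (h' : IsSol α ρ q lam z r) :
    IsSol α ρ q lam (fun t => y t - z t) (fun t => p t - r t) := fun t ht =>
  ⟨((h t ht).1.sub (h' t ht).1).congr_deriv (by ring),
    ((h t ht).2.sub (h' t ht).2).congr_deriv (by ring)⟩

theorem eq_zero (hα : ContinuousOn α (Icc 0 1)) (hρ : ContinuousOn ρ (Icc 0 1))
    (hq : ContinuousOn q (Icc 0 1)) (h : IsSol α ρ q lam y p) (hy : y 0 = 0) (hp : p 0 = 0) :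
    ∀ t ∈ Icc (0 : ℝ) 1, y t = 0 ∧ p t = 0 := by
  obtain ⟨C, hC⟩ := isCompact_Icc.exists_bound_of_continuousOn hα
  obtain ⟨D, hD⟩ := isCompact_Icc.exists_bound_of_continuousOn (hq.sub (continuousOn_const.mul hρ))
  have key := eq_zero_of_abs_deriv_le_mul_abs_self_of_eq_zero_right (f := fun t => (y t, p t))
    (f' := fun t => (α t * p t, (q t - lam * ρ t) * y t)) (K := max C D) (a := 0) (b := 1)
    (h.continuousOn_fst.prodMk h.continuousOn_snd)
    (fun t ht => (hasDerivWithinAt_unit_Ici ht (h t (Ico_subset_Icc_self ht)).1).prodMk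
      (hasDerivWithinAt_unit_Ici ht (h t (Ico_subset_Icc_self ht)).2))
    (by simp [hy, hp]) (fun t ht => ?_)
  · intro t ht
    exact Prod.mk.inj (key t ht)
  · have ht := Ico_subset_Icc_self ht
    have hC0 : 0 ≤ C := (norm_nonneg _).trans (hC t ht)
    have hyn : ‖y t‖ ≤ ‖(y t, p t)‖ := norm_fst_le (y t, p t)
    have hpn : ‖p t‖ ≤ ‖(y t, p t)‖ := norm_snd_le (y t, p t)
    refine norm_prod_le_iff.mpr ⟨?_, ?_⟩
    · rw [norm_mul]
      exact mul_le_mul ((hC t ht).trans (le_max_left _ _)) hpn (norm_nonneg _)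
        (hC0.trans (le_max_left _ _))
    · rw [norm_mul]
      exact mul_le_mul ((hD t ht).trans (le_max_right _ _)) hyn (norm_nonneg _)
        (hC0.trans (le_max_left _ _))

/-- A solution with vanishing first component has vanishing flux. -/
theorem snd_eq_zero (hα : ∀ t ∈ Icc (0 : ℝ) 1, 0 < α t) (h : IsSol α ρ q lam y p)
    (hy : ∀ t ∈ Icc (0 : ℝ) 1, y t = 0) : ∀ t ∈ Icc (0 : ℝ) 1, p t = 0 := fun t ht => by
  have := hasDerivWithinAt_unit_unique ht (h t ht).1
    ((hasDerivWithinAt_const t (Icc (0 : ℝ) 1) (0 : ℝ)).congr hy (hy t ht))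
  exact (mul_eq_zero.mp this).resolve_left (hα t ht).ne'

/-- The solutions vanishing at `0` form a line. -/
theorem exists_eq_const_mul (hα : ContinuousOn α (Icc 0 1)) (hρ : ContinuousOn ρ (Icc 0 1))
    (hq : ContinuousOn q (Icc 0 1)) (h : IsSol α ρ q lam y p) (hy : y 0 = 0) (hp : p 0 ≠ 0)
    (h' : IsSol α ρ q lam z r) (hz : z 0 = 0) :
    ∃ c, ∀ t ∈ Icc (0 : ℝ) 1, z t = c * y t ∧ r t = c * p t := by
  refine ⟨r 0 / p 0, fun t ht => ?_⟩
  have := (h'.sub (h.const_mul (r 0 / p 0))).eq_zero hα hρ hq (by simp [hy, hz])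
    (by simp [div_mul_cancel₀ _ hp]) t ht
  exact ⟨sub_eq_zero.mp this.1, sub_eq_zero.mp this.2⟩

end IsSol

/-! ### Rods on the unit interval -/

/-- Coefficients of a rod transported to `[0, 1]`: the reciprocal conductivity `α` and the density
`ρ` are positive and continuously differentiable, the potential `q` is continuous and positive. -/
structure IsUnitRod (α ρ q : ℝ → ℝ) : Prop where
  differentiableOn_recip : DifferentiableOn ℝ α (Icc 0 1)
  continuousOn_deriv_recip : ContinuousOn (derivWithin α (Icc 0 1)) (Icc 0 1)
  differentiableOn_density : DifferentiableOn ℝ ρ (Icc 0 1)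
  continuousOn_deriv_density : ContinuousOn (derivWithin ρ (Icc 0 1)) (Icc 0 1)
  continuousOn_potential : ContinuousOn q (Icc 0 1)
  recip_pos : ∀ t ∈ Icc (0 : ℝ) 1, 0 < α t
  density_pos : ∀ t ∈ Icc (0 : ℝ) 1, 0 < ρ t
  potential_pos : ∀ t ∈ Icc (0 : ℝ) 1, 0 < q t

theorem exists_pos_bounds_of_continuousOn {f : ℝ → ℝ} (hf : ContinuousOn f (Icc 0 1))
    (hpos : ∀ t ∈ Icc (0 : ℝ) 1, 0 < f t) :
    ∃ c C : ℝ, 0 < c ∧ 0 < C ∧ ∀ t ∈ Icc (0 : ℝ) 1, c ≤ f t ∧ f t ≤ C := by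
  have hne : (Icc (0 : ℝ) 1).Nonempty := nonempty_Icc.mpr zero_le_one
  obtain ⟨a, ha, ha'⟩ := isCompact_Icc.exists_isMinOn hne hf
  obtain ⟨b, hb, hb'⟩ := isCompact_Icc.exists_isMaxOn hne hf
  exact ⟨f a, f b, hpos a ha, hpos b hb, fun t ht => ⟨ha' ht, hb' ht⟩⟩

namespace IsUnitRod

variable {α ρ q : ℝ → ℝ}

theorem continuousOn_recip (h : IsUnitRod α ρ q) : ContinuousOn α (Icc 0 1) :=
  h.differentiableOn_recip.continuousOn

theorem continuousOn_density (h : IsUnitRod α ρ q) : ContinuousOn ρ (Icc 0 1) :=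
  h.differentiableOn_density.continuousOn

/-! ### High-frequency energy estimate -/

/-- The energy `K ρ y² + α p²` at any point is controlled by its value at `1`, uniformly in `K` and
in the spectral parameter `nu` as long as `nu` stays within distance one of `K`: the two terms of
order `K` in the derivative of the energy cancel because `ρ` and `α` are continuously
differentiable. -/
theorem exists_energy_bound (h : IsUnitRod α ρ q) :
    ∃ C : ℝ, 0 < C ∧ ∀ K nu : ℝ, 1 ≤ K → |K - nu| ≤ 1 → ∀ y p : ℝ → ℝ, IsSol α ρ q nu y p →
      ∀ t ∈ Icc (0 : ℝ) 1, K * y t ^ 2 ≤ C * (K * y 1 ^ 2 + p 1 ^ 2) := by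
  obtain ⟨a, A, ha, hA, hα⟩ := exists_pos_bounds_of_continuousOn h.continuousOn_recip h.recip_pos
  obtain ⟨b, B, hb, hB, hρ⟩ := exists_pos_bounds_of_continuousOn h.continuousOn_density
    h.density_pos
  obtain ⟨q₀, Q, -, hQ, hq⟩ := exists_pos_bounds_of_continuousOn h.continuousOn_potential
    h.potential_pos
  obtain ⟨A', hα'⟩ := isCompact_Icc.exists_bound_of_continuousOn h.continuousOn_deriv_recip
  obtain ⟨B', hρ'⟩ := isCompact_Icc.exists_bound_of_continuousOn h.continuousOn_deriv_density
  have hm0 : (0 : ℝ) ∈ Icc (0 : ℝ) 1 := left_mem_Icc.mpr zero_le_one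
  have hA' : 0 ≤ A' := (norm_nonneg _).trans (hα' 0 hm0)
  have hB' : 0 ≤ B' := (norm_nonneg _).trans (hρ' 0 hm0)
  set D : ℝ := B' / b + A' / a + (Q + B) * (A / b + 1) with hD
  refine ⟨Real.exp D * (A + B) / b, by positivity, fun K nu hK hKn y p hs t ht => ?_⟩
  have hK0 : 0 < K := by linarith
  have hmono : MonotoneOn
      (fun t => Real.exp (D * t) * (K * (ρ t * y t ^ 2) + α t * p t ^ 2)) (Icc 0 1) := by
    refine monotoneOn_unit_of_hasDerivWithinAt (f' := fun t => Real.exp (D * t) *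
      (D * (K * (ρ t * y t ^ 2) + α t * p t ^ 2) + K * derivWithin ρ (Icc 0 1) t * y t ^ 2
        + derivWithin α (Icc 0 1) t * p t ^ 2
        + 2 * α t * (q t + (K - nu) * ρ t) * (y t * p t)))
      (fun t ht => ?_) (fun t ht => ?_)
    · have d1 := (h.differentiableOn_density t ht).hasDerivWithinAt
      have d2 := (h.differentiableOn_recip t ht).hasDerivWithinAt
      have d3 := (((hasDerivWithinAt_id t (Icc (0 : ℝ) 1)).const_mul D).exp).mul
        (((d1.mul ((hs t ht).1.pow 2)).const_mul K).add (d2.mul ((hs t ht).2.pow 2)))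
      refine d3.congr_deriv ?_
      simp only [Pi.mul_apply, Pi.pow_apply, Pi.add_apply, id]
      push_cast
      ring
    · refine mul_nonneg (Real.exp_pos _).le ?_
      have e1 : -(B' / b * (K * (ρ t * y t ^ 2))) ≤ K * derivWithin ρ (Icc 0 1) t * y t ^ 2 := by
        have g1 : -B' ≤ derivWithin ρ (Icc 0 1) t := (abs_le.mp (hρ' t ht)).1
        have g2 : B' ≤ B' / b * ρ t := by
          calc B' = B' / b * b := by field_simp
            _ ≤ B' / b * ρ t := mul_le_mul_of_nonneg_left (hρ t ht).1 (by positivity)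
        have : 0 ≤ (derivWithin ρ (Icc 0 1) t + B' / b * ρ t) * (K * y t ^ 2) :=
          mul_nonneg (by linarith) (by positivity)
        linarith
      have e2 : -(A' / a * (α t * p t ^ 2)) ≤ derivWithin α (Icc 0 1) t * p t ^ 2 := by
        have g1 : -A' ≤ derivWithin α (Icc 0 1) t := (abs_le.mp (hα' t ht)).1
        have g2 : A' ≤ A' / a * α t := by
          calc A' = A' / a * a := by field_simp
            _ ≤ A' / a * α t := mul_le_mul_of_nonneg_left (hα t ht).1 (by positivity)
        have : 0 ≤ (derivWithin α (Icc 0 1) t + A' / a * α t) * (p t ^ 2) :=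
          mul_nonneg (by linarith) (by positivity)
        linarith
      have hα0 := h.recip_pos t ht
      have hρ0 := h.density_pos t ht
      have e3 : -((Q + B) * (A / b * (K * (ρ t * y t ^ 2)) + α t * p t ^ 2)) ≤
          2 * α t * (q t + (K - nu) * ρ t) * (y t * p t) := by
        have g1 : |q t + (K - nu) * ρ t| ≤ Q + B := by
          refine (abs_add_le _ _).trans (add_le_add ?_ ?_)
          · rw [abs_of_pos (h.potential_pos t ht)]; exact (hq t ht).2
          · rw [abs_mul, abs_of_pos hρ0]
            calc |K - nu| * ρ t ≤ 1 * B :=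
                  mul_le_mul hKn (hρ t ht).2 hρ0.le zero_le_one
              _ = B := one_mul B
        have g2 : α t * (2 * |y t * p t|) ≤ A / b * (K * (ρ t * y t ^ 2)) + α t * p t ^ 2 := by
          have g3 : 2 * |y t * p t| ≤ y t ^ 2 + p t ^ 2 := by
            rw [abs_mul, ← sq_abs (y t), ← sq_abs (p t)]
            nlinarith [sq_nonneg (|y t| - |p t|)]
          have g4 : α t * y t ^ 2 ≤ A / b * (K * (ρ t * y t ^ 2)) := by
            have : b ≤ K * ρ t := by nlinarith [(hρ t ht).1]
            calc α t * y t ^ 2 ≤ A * y t ^ 2 := by gcongr; exact (hα t ht).2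
              _ = A / b * (b * y t ^ 2) := by field_simp
              _ ≤ A / b * (K * ρ t * y t ^ 2) := by gcongr
              _ = _ := by ring
          nlinarith
        have g5 : |2 * α t * (q t + (K - nu) * ρ t) * (y t * p t)| ≤
            (Q + B) * (A / b * (K * (ρ t * y t ^ 2)) + α t * p t ^ 2) := by
          calc |2 * α t * (q t + (K - nu) * ρ t) * (y t * p t)|
              = |q t + (K - nu) * ρ t| * (α t * (2 * |y t * p t|)) := by
                rw [abs_mul, abs_mul, abs_mul, abs_of_pos hα0, abs_two]; ring
            _ ≤ (Q + B) * (A / b * (K * (ρ t * y t ^ 2)) + α t * p t ^ 2) :=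
                mul_le_mul g1 g2 (by positivity) (by positivity)
        exact (abs_le.mp g5).1
      have f1 : 0 ≤ K * (ρ t * y t ^ 2) := by positivity
      have f2 : 0 ≤ α t * p t ^ 2 := by positivity
      have f3 : 0 ≤ B' / b * (α t * p t ^ 2) := by positivity
      have f4 : 0 ≤ A' / a * (K * (ρ t * y t ^ 2)) := by positivity
      have f5 : 0 ≤ (Q + B) * (K * (ρ t * y t ^ 2)) := by positivity
      have f6 : 0 ≤ (Q + B) * (A / b * (α t * p t ^ 2)) := by positivity
      rw [hD]
      linarith
  have hm1 : (1 : ℝ) ∈ Icc (0 : ℝ) 1 := right_mem_Icc.mpr zero_le_one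
  have key := hmono ht hm1 ht.2
  simp only [mul_one] at key
  have hD0 : 0 ≤ D := by positivity
  have hexp : 1 ≤ Real.exp (D * t) := Real.one_le_exp (mul_nonneg hD0 ht.1)
  have hα0 := h.recip_pos t ht
  have hρ0 := h.density_pos t ht
  have k1 : b * (K * y t ^ 2) ≤ Real.exp (D * t) * (K * (ρ t * y t ^ 2) + α t * p t ^ 2) := by
    calc b * (K * y t ^ 2) ≤ ρ t * (K * y t ^ 2) := by gcongr; exact (hρ t ht).1
      _ ≤ K * (ρ t * y t ^ 2) + α t * p t ^ 2 := by
          have : 0 ≤ α t * p t ^ 2 := by positivity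
          linarith
      _ ≤ _ := le_mul_of_one_le_left (by positivity) hexp
  have k2 : K * (ρ 1 * y 1 ^ 2) + α 1 * p 1 ^ 2 ≤ (A + B) * (K * y 1 ^ 2 + p 1 ^ 2) := by
    have g1 : 0 ≤ (B - ρ 1) * (K * y 1 ^ 2) :=
      mul_nonneg (by linarith [(hρ 1 hm1).2]) (by positivity)
    have g2 : 0 ≤ (A - α 1) * p 1 ^ 2 :=
      mul_nonneg (by linarith [(hα 1 hm1).2]) (by positivity)
    have g3 : 0 ≤ A * (K * y 1 ^ 2) := by positivity
    have g4 : 0 ≤ B * p 1 ^ 2 := by positivity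
    linarith
  rw [div_mul_eq_mul_div, le_div_iff₀ hb]
  calc K * y t ^ 2 * b = b * (K * y t ^ 2) := by ring
    _ ≤ Real.exp D * (K * (ρ 1 * y 1 ^ 2) + α 1 * p 1 ^ 2) := k1.trans key
    _ ≤ Real.exp D * ((A + B) * (K * y 1 ^ 2 + p 1 ^ 2)) := by gcongr
    _ = _ := by ring

/-- The Wronskian at `1` of two solutions vanishing at `0` is small when the spectral parameters
are close. -/
theorem exists_wronskian_bound (h : IsUnitRod α ρ q) :
    ∃ C : ℝ, 0 < C ∧ ∀ K lam mu : ℝ, 1 ≤ K → |K - lam| ≤ 1 → |K - mu| ≤ 1 →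
      ∀ y p z r : ℝ → ℝ, IsSol α ρ q lam y p → IsSol α ρ q mu z r → y 0 = 0 → z 0 = 0 →
      (K * (y 1 * r 1 - p 1 * z 1)) ^ 2 ≤
        (C * |mu - lam|) ^ 2 * ((K * y 1 ^ 2 + p 1 ^ 2) * (K * z 1 ^ 2 + r 1 ^ 2)) := by
  obtain ⟨C, hC, hE⟩ := h.exists_energy_bound
  obtain ⟨b, B, hb, hB, hρ⟩ := exists_pos_bounds_of_continuousOn h.continuousOn_density
    h.density_pos
  refine ⟨B * C, by positivity, fun K lam mu hK hl hm y p z r hy hz hy0 hz0 => ?_⟩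
  have hK0 : 0 < K := by linarith
  set N := K * y 1 ^ 2 + p 1 ^ 2 with hN
  set N' := K * z 1 ^ 2 + r 1 ^ 2 with hN'
  have hN0 : 0 ≤ N := by positivity
  have hN0' : 0 ≤ N' := by positivity
  have hd : ∀ t ∈ Icc (0 : ℝ) 1, HasDerivWithinAt (fun t => y t * r t - p t * z t)
      (-((mu - lam) * ρ t * (y t * z t))) (Icc 0 1) t := fun t ht =>
    (((hy t ht).1.mul (hz t ht).2).sub ((hy t ht).2.mul (hz t ht).1)).congr_deriv (by ring)
  have hbd : ∀ t ∈ Icc (0 : ℝ) 1,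
      ‖-((mu - lam) * ρ t * (y t * z t))‖ ≤ |mu - lam| * B * (C * √(N * N') / K) := fun t ht => by
    have h1 : |y t * z t| ≤ C * √(N * N') / K := by
      rw [le_div_iff₀ hK0]
      refine abs_le_of_sq_le_sq' ?_ (by positivity) |>.2
      rw [mul_pow, mul_pow, Real.sq_sqrt (by positivity), sq_abs]
      have := mul_le_mul (hE K lam hK hl y p hy t ht) (hE K mu hK hm z r hz t ht)
        (by positivity) (by positivity)
      calc (y t * z t) ^ 2 * K ^ 2 = K * y t ^ 2 * (K * z t ^ 2) := by ring
        _ ≤ _ := this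
        _ = C ^ 2 * (N * N') := by ring
    rw [norm_neg, norm_mul, norm_mul, Real.norm_eq_abs, Real.norm_eq_abs, Real.norm_eq_abs,
      abs_of_pos (h.density_pos t ht)]
    gcongr
    exact (hρ t ht).2
  have key := (convex_Icc (0 : ℝ) 1).norm_image_sub_le_of_norm_hasDerivWithin_le hd hbd
    (left_mem_Icc.mpr zero_le_one) (right_mem_Icc.mpr zero_le_one)
  simp only [hy0, hz0, zero_mul, mul_zero, sub_zero, norm_one, mul_one, Real.norm_eq_abs] at key
  calc (K * (y 1 * r 1 - p 1 * z 1)) ^ 2 = (K * |y 1 * r 1 - p 1 * z 1|) ^ 2 := by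
        rw [mul_pow, mul_pow, sq_abs]
    _ ≤ (K * (|mu - lam| * B * (C * √(N * N') / K))) ^ 2 := by gcongr
    _ = (|mu - lam| * B * C * √(N * N')) ^ 2 := by congr 1; field_simp
    _ = _ := by rw [mul_pow _ (√(N * N')), Real.sq_sqrt (by positivity)]; ring

end IsUnitRod

/-! ### The phase of a rod loaded with a mass -/

/-- `Θ` is a phase, at scale `K`, of the rod `(α, ρ, q)` loaded with the mass `m` at `1`: for each
spectral parameter `lam`, `Θ lam` is a polar angle of `(y 1, (p 1 - lam m y 1) / K)` for a nonzero
solution `(y, p)` with `y 0 = 0`. The remaining fields record that the lift of the angle is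
continuous and strictly increasing, together with its size at `0` and at large `lam`. -/
structure IsPhase (α ρ q : ℝ → ℝ) (m K : ℝ) (Θ : ℝ → ℝ) : Prop where
  continuous : Continuous Θ
  strictMono : StrictMono Θ
  zero_le : Θ 0 ≤ Real.pi / 2
  le_apply : ∀ c lam : ℝ, 0 ≤ lam → (∀ t ∈ Icc (0 : ℝ) 1, c ≤ K * α t) →
    (∀ t ∈ Icc (0 : ℝ) 1, c ≤ (lam * ρ t - q t) / K) → c ≤ Θ lam
  polar : ∀ lam, ∃ (R : ℝ) (y p : ℝ → ℝ), 0 < R ∧ IsSol α ρ q lam y p ∧ y 0 = 0 ∧ p 0 ≠ 0 ∧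
    y 1 = R * Real.sin (Θ lam) ∧ p 1 - lam * m * y 1 = K * (R * Real.cos (Θ lam))

/-- The mass acts on the angle like a unit interval on which `y' = 0` and `p' = -lam m y`; this
makes the phase the end value of two consecutive Prüfer equations. -/
theorem IsUnitRod.exists_isPhase {α ρ q : ℝ → ℝ} (h : IsUnitRod α ρ q) {m K : ℝ} (hm : 0 ≤ m)
    (hK : 0 < K) : ∃ Θ, IsPhase α ρ q m K Θ := by
  have hα := h.continuousOn_recip
  have hρ := h.continuousOn_density
  have hq := h.continuousOn_potential
  have hA : ContinuousOn (fun t => K * α t) (Icc 0 1) := continuousOn_const.mul hα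
  have hB : ∀ lam : ℝ, ContinuousOn (fun t => (lam * ρ t - q t) / K) (Icc 0 1) := fun lam =>
    ((continuousOn_const.mul hρ).sub hq).div_const K
  have hz : ContinuousOn (fun _ : ℝ => (0 : ℝ)) (Icc 0 1) := continuousOn_const
  have hb : ∀ lam : ℝ, ContinuousOn (fun _ : ℝ => lam * m / K) (Icc 0 1) := fun _ =>
    continuousOn_const
  have hm0 : (0 : ℝ) ∈ Icc (0 : ℝ) 1 := left_mem_Icc.mpr zero_le_one
  have hm1 : (1 : ℝ) ∈ Icc (0 : ℝ) 1 := right_mem_Icc.mpr zero_le_one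
  choose θ hθ0 hθ using fun lam => exists_isPrufer hA (hB lam) 0
  choose φ hφ0 hφ using fun lam => exists_isPrufer hz (hb lam) (θ lam 1)
  refine ⟨fun lam => φ lam 1, ?_, ?_, ?_, ?_, ?_⟩
  · rw [continuous_iff_continuousAt]
    intro lam
    obtain ⟨A', hA'⟩ := isCompact_Icc.exists_bound_of_continuousOn hA
    obtain ⟨B', hB'⟩ := isCompact_Icc.exists_bound_of_continuousOn (hB lam)
    obtain ⟨D, hD⟩ := isCompact_Icc.exists_bound_of_continuousOn (hρ.div_const K)
    have hD0 : 0 ≤ D := (norm_nonneg _).trans (hD 0 hm0)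
    set C := max 1 (max A' B') with hC
    set C' := max 1 |lam * m / K| with hC'
    have h1 : ∀ mu, |θ mu 1 - θ lam 1| ≤ |mu - lam| * D * Real.exp (2 * C) := fun mu => by
      have := IsPrufer.abs_sub_le (le_max_left _ _ : 1 ≤ C)
        (fun t ht => (hA' t ht).trans ((le_max_left _ _).trans (le_max_right _ _)))
        (fun t ht => (hB' t ht).trans ((le_max_right _ _).trans (le_max_right _ _)))
        (by positivity : 0 ≤ |mu - lam| * D) (fun t ht => ?_) (hθ lam) (hθ mu)
      · simpa [hθ0] using this
      · have e : (mu * ρ t - q t) / K - (lam * ρ t - q t) / K = (mu - lam) * (ρ t / K) := by ring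
        rw [e, abs_mul]
        exact mul_le_mul_of_nonneg_left (hD t ht) (abs_nonneg _)
    have h2 : ∀ mu, |φ mu 1 - φ lam 1| ≤
        (|mu - lam| * D * Real.exp (2 * C) + |mu - lam| * |m / K|) * Real.exp (2 * C') :=
      fun mu => by
      have := IsPrufer.abs_sub_le (le_max_left _ _ : 1 ≤ C')
        (fun t _ => by simp)
        (fun t _ => le_max_right _ _)
        (by positivity : 0 ≤ |mu - lam| * |m / K|) (fun t ht => ?_) (hφ lam) (hφ mu)
      · rw [hφ0, hφ0] at this
        refine this.trans ?_
        gcongr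
        exact h1 mu
      · rw [← abs_mul]
        exact le_of_eq (congrArg _ (by ring))
    refine tendsto_iff_dist_tendsto_zero.mpr (squeeze_zero (fun _ => dist_nonneg) h2 ?_)
    have hc : Continuous fun mu : ℝ => (|mu - lam| * D * Real.exp (2 * C) + |mu - lam| * |m / K|)
        * Real.exp (2 * C') := by fun_prop
    have := hc.tendsto lam
    simpa using this
  · intro lam mu hlm
    have h1 : θ lam 1 < θ mu 1 := (hθ lam).lt_of_coeff_lt hA (hB mu) (hθ mu)
      (mul_pos hK (h.recip_pos 0 hm0)) (fun t ht => by
        have := h.density_pos t ht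
        gcongr) (by rw [hθ0, hθ0])
    exact (hφ lam).lt_of_lt (hb mu) hz (hφ mu) (fun _ _ => le_rfl)
      (fun t _ => by gcongr) (by rwa [hφ0, hφ0])
  · -- the constant angle `π / 2` solves the equation with `B = 0`
    have hc : ∀ A : ℝ → ℝ, IsPrufer A (fun _ => 0) (fun _ => Real.pi / 2) := fun A t _ => by
      simpa using hasDerivWithinAt_const t (Icc (0 : ℝ) 1) (Real.pi / 2)
    have h1 : θ 0 1 ≤ Real.pi / 2 := (hθ 0).le_of_le hz hA (hc _) (fun _ _ => le_rfl)
      (fun t ht => by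
        have := h.potential_pos t ht
        simp only [zero_mul, zero_sub]
        exact div_nonpos_of_nonpos_of_nonneg (by linarith) hK.le)
      (by rw [hθ0]; positivity)
    exact (hφ 0).le_of_le hz hz (hc _) (fun _ _ => le_rfl) (fun t _ => by simp)
      (by rwa [hφ0])
  · intro c lam hlam hcA hcB
    -- the angle `c t` solves the equation with `A = B = c`
    have hlin : IsPrufer (fun _ => c) (fun _ => c) (fun t => c * t) := fun t _ => by
      refine ((hasDerivWithinAt_id t _).const_mul c).congr_deriv ?_
      linear_combination -c * Real.cos_sq_add_sin_sq (c * t)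
    have h1 : c * 1 ≤ θ lam 1 := hlin.le_of_le (hB lam) hA (hθ lam) hcA hcB
      (by rw [hθ0, mul_zero])
    have hconst : IsPrufer (fun _ => 0) (fun _ => 0) (fun _ => θ lam 1) := fun t _ => by
      simpa using hasDerivWithinAt_const t (Icc (0 : ℝ) 1) (θ lam 1)
    have h2 : θ lam 1 ≤ φ lam 1 := hconst.le_of_le (θ := fun _ => θ lam 1) (hb lam) hz (hφ lam) (fun _ _ => le_rfl)
      (fun t _ => by positivity) (by rw [hφ0])
    linarith
  · intro lam
    obtain ⟨R, hR, hs⟩ := (hθ lam).exists_isSol hK hα hρ hq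
    have hφ' : IsPrufer (fun t => K * (0 : ℝ)) (fun t => (lam * m - 0) / K) (φ lam) := by
      simpa using hφ lam
    obtain ⟨S, hS, hs'⟩ := IsPrufer.exists_isSol (α := fun _ => 0) (ρ := fun _ => m)
      (q := fun _ => 0) hK continuousOn_const continuousOn_const continuousOn_const hφ'
    -- on the auxiliary interval `y` is constant and `p` is affine
    have hy : ∀ t ∈ Icc (0 : ℝ) 1, S t * Real.sin (φ lam t) = S 0 * Real.sin (φ lam 0) :=
      fun t ht => by
      have := (convex_Icc (0 : ℝ) 1).norm_image_sub_le_of_norm_hasDerivWithin_le (C := 0)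
        (fun s hs => (hs' s hs).1) (fun s _ => by simp) hm0 ht
      simp only [zero_mul] at this
      exact sub_eq_zero.mp (norm_le_zero_iff.mp this)
    have hp : K * (S 1 * Real.cos (φ lam 1)) + lam * m * (S 0 * Real.sin (φ lam 0)) * 1
        = K * (S 0 * Real.cos (φ lam 0)) + lam * m * (S 0 * Real.sin (φ lam 0)) * 0 := by
      have := (convex_Icc (0 : ℝ) 1).norm_image_sub_le_of_norm_hasDerivWithin_le (C := 0)
        (f := fun t => K * (S t * Real.cos (φ lam t)) + lam * m * (S 0 * Real.sin (φ lam 0)) * t)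
        (fun s hs => ((hs' s hs).2.add ((hasDerivWithinAt_id s _).const_mul
          (lam * m * (S 0 * Real.sin (φ lam 0))))))
        (fun s hs => by beta_reduce; rw [hy s hs]; simp) hm0 hm1
      simp only [zero_mul] at this
      exact sub_eq_zero.mp (norm_le_zero_iff.mp this)
    have hy1 := hy 1 hm1
    rw [hφ0] at hp hy1
    have hS0 := (hS 0).ne'
    refine ⟨R 1 * S 1 / S 0, _, _, div_pos (mul_pos (hR 1) (hS 1)) (hS 0), hs, by simp [hθ0], ?_,
      ?_, ?_⟩
    · simp [hθ0, hK.ne', (hR 0).ne']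
    · field_simp
      linear_combination (-R 1) * hy1
    · field_simp
      linear_combination (-R 1) * hp

/-- The phases at scale `K` are Lipschitz near the spectral parameter `K`, uniformly in `K ≥ 1`. -/
theorem IsUnitRod.exists_phase_lipschitz {α ρ q : ℝ → ℝ} (h : IsUnitRod α ρ q) {m : ℝ}
    (hm : 0 ≤ m) : ∃ C : ℝ, 0 < C ∧ ∀ K lam mu : ℝ, 1 ≤ K → lam ∈ Icc (K - 1) K →
      mu ∈ Icc (K - 1) K → ∀ Θ, IsPhase α ρ q m K Θ →
      |Real.sin (Θ mu - Θ lam)| ≤ C * |mu - lam| := by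
  obtain ⟨C, hC, hW⟩ := h.exists_wronskian_bound
  refine ⟨C * (2 + 2 * m ^ 2) + m, by positivity, fun K lam mu hK hl hμ Θ hΘ => ?_⟩
  have hK0 : 0 < K := by linarith
  obtain ⟨R, y, p, hR, hs, hy0, -, hy1, hp1⟩ := hΘ.polar lam
  obtain ⟨S, z, r, hS, hs', hz0, -, hz1, hr1⟩ := hΘ.polar mu
  have hw := hW K lam mu hK (abs_le.mpr ⟨by linarith [hl.2], by linarith [hl.1]⟩)
    (abs_le.mpr ⟨by linarith [hμ.2], by linarith [hμ.1]⟩) y p z r hs hs' hy0 hz0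
  -- the flux before the mass is bounded by the amplitude after the mass
  have hN : ∀ nu ∈ Icc (K - 1) K, ∀ Y P T a : ℝ, 0 < T → Y = T * Real.sin a →
      P - nu * m * Y = K * (T * Real.cos a) →
      K * Y ^ 2 + P ^ 2 ≤ (2 + 2 * m ^ 2) * (K * T) ^ 2 := by
    intro nu hnu Y P T a hT hY hP
    have hnu0 : 0 ≤ nu := by linarith [hnu.1]
    have e1 : P ^ 2 ≤ 2 * (K * (T * Real.cos a)) ^ 2 + 2 * (nu * m * Y) ^ 2 := by
      rw [eq_add_of_sub_eq hP]
      nlinarith [sq_nonneg (K * (T * Real.cos a) - nu * m * Y)]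
    have e2 : (nu * m * Y) ^ 2 ≤ m ^ 2 * (K * Y) ^ 2 := by
      calc (nu * m * Y) ^ 2 = nu ^ 2 * (m * Y) ^ 2 := by ring
        _ ≤ K ^ 2 * (m * Y) ^ 2 := by gcongr; exact hnu.2
        _ = _ := by ring
    have e3 : K * Y ^ 2 ≤ (K * Y) ^ 2 := by
      calc K * Y ^ 2 ≤ K * (K * Y ^ 2) := le_mul_of_one_le_left (by positivity) hK
        _ = _ := by ring
    have e4 : (K * (T * Real.cos a)) ^ 2 + (K * Y) ^ 2 = (K * T) ^ 2 := by
      rw [hY]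
      linear_combination (K * T) ^ 2 * Real.cos_sq_add_sin_sq a
    have e5 : 0 ≤ (K * (T * Real.cos a)) ^ 2 := sq_nonneg _
    have e6 : 0 ≤ m ^ 2 * (K * (T * Real.cos a)) ^ 2 := by positivity
    have e7 : 0 ≤ (K * Y) ^ 2 := sq_nonneg _
    rw [← e4]
    nlinarith
  have hN1 := hN lam hl _ _ _ _ hR hy1 hp1
  have hN2 := hN mu hμ _ _ _ _ hS hz1 hr1
  have hw' : |y 1 * r 1 - p 1 * z 1| ≤
      C * |mu - lam| * (2 + 2 * m ^ 2) * (K * (R * S)) := by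
    have : K * |y 1 * r 1 - p 1 * z 1| ≤ C * |mu - lam| * (2 + 2 * m ^ 2) * (K * R * (K * S)) := by
      refine abs_le_of_sq_le_sq' ?_ (by positivity) |>.2
      calc (K * |y 1 * r 1 - p 1 * z 1|) ^ 2 = (K * (y 1 * r 1 - p 1 * z 1)) ^ 2 := by
            rw [mul_pow, mul_pow, sq_abs]
        _ ≤ _ := hw
        _ ≤ (C * |mu - lam|) ^ 2 * (((2 + 2 * m ^ 2) * (K * R) ^ 2) *
              ((2 + 2 * m ^ 2) * (K * S) ^ 2)) := by gcongr
        _ = _ := by ring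
    refine le_of_mul_le_mul_left (this.trans_eq ?_) hK0
    ring
  have hsin : K * (R * S) * Real.sin (Θ mu - Θ lam) =
      -(y 1 * r 1 - p 1 * z 1) + (mu - lam) * m * (y 1 * z 1) := by
    have e : y 1 * (r 1 - mu * m * z 1) - (p 1 - lam * m * y 1) * z 1 =
        -(K * (R * S) * Real.sin (Θ mu - Θ lam)) := by
      rw [hp1, hr1, hy1, hz1, Real.sin_sub]; ring
    linear_combination e
  have hyz : |y 1 * z 1| ≤ R * S := by
    rw [hy1, hz1, abs_mul, abs_mul, abs_mul, abs_of_pos hR, abs_of_pos hS]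
    gcongr
    · exact mul_le_of_le_one_right hR.le (Real.abs_sin_le_one _)
    · exact mul_le_of_le_one_right hS.le (Real.abs_sin_le_one _)
  have hRS : 0 < K * (R * S) := by positivity
  have hfin : K * (R * S) * |Real.sin (Θ mu - Θ lam)| ≤
      K * (R * S) * ((C * (2 + 2 * m ^ 2) + m) * |mu - lam|) := by
    calc K * (R * S) * |Real.sin (Θ mu - Θ lam)|
        = |K * (R * S) * Real.sin (Θ mu - Θ lam)| := by rw [abs_mul, abs_of_pos hRS]
      _ ≤ |y 1 * r 1 - p 1 * z 1| + |mu - lam| * m * |y 1 * z 1| := by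
          rw [hsin]
          refine (abs_add_le _ _).trans (le_of_eq ?_)
          rw [abs_neg, abs_mul, abs_mul, abs_of_nonneg hm]
      _ ≤ C * |mu - lam| * (2 + 2 * m ^ 2) * (K * (R * S)) + |mu - lam| * m * (K * (R * S)) := by
          gcongr
          exact hyz.trans (le_mul_of_one_le_left (by positivity) hK)
      _ = _ := by ring
  exact le_of_mul_le_mul_left hfin hRS

/-! ### Two rods joined at a point mass -/

/-- Two solutions on `[0, 1]`, both vanishing at `0`, which agree at `1` and whose fluxes there
balance the mass `M`; each rod is parametrised from its clamped end towards the mass. -/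
structure IsPairSol (α₁ ρ₁ q₁ α₂ ρ₂ q₂ : ℝ → ℝ) (M lam : ℝ) (y p z r : ℝ → ℝ) : Prop where
  left : IsSol α₁ ρ₁ q₁ lam y p
  right : IsSol α₂ ρ₂ q₂ lam z r
  left_zero : y 0 = 0
  right_zero : z 0 = 0
  continuity : y 1 = z 1
  balance : p 1 + r 1 = lam * M * y 1

/-- The parameters for which the joined rods have a nonzero solution. -/
def pairSpectrum (α₁ ρ₁ q₁ α₂ ρ₂ q₂ : ℝ → ℝ) (M : ℝ) : Set ℝ :=
  {lam | ∃ y p z r : ℝ → ℝ, IsPairSol α₁ ρ₁ q₁ α₂ ρ₂ q₂ M lam y p z r ∧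
    ((∃ t ∈ Icc (0 : ℝ) 1, y t ≠ 0) ∨ ∃ t ∈ Icc (0 : ℝ) 1, z t ≠ 0)}

section Pair

variable {α₁ ρ₁ q₁ α₂ ρ₂ q₂ : ℝ → ℝ} {M : ℝ}

/-- In polar coordinates at the mass, half of which is attached to each rod, the two matching
conditions say that the amplitude vectors of the rods are mirror images of each other. -/
theorem IsPairSol.exists_coords (h₁ : IsUnitRod α₁ ρ₁ q₁) (h₂ : IsUnitRod α₂ ρ₂ q₂) {K lam : ℝ}
    (hK : 0 < K) {a b R S : ℝ} {φ φ' ψ ψ' y p z r : ℝ → ℝ}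
    (hφ : IsSol α₁ ρ₁ q₁ lam φ φ') (hφ0 : φ 0 = 0) (hφ0' : φ' 0 ≠ 0)
    (hφ1 : φ 1 = R * Real.sin a) (hφ1' : φ' 1 - lam * (M / 2) * φ 1 = K * (R * Real.cos a))
    (hψ : IsSol α₂ ρ₂ q₂ lam ψ ψ') (hψ0 : ψ 0 = 0) (hψ0' : ψ' 0 ≠ 0)
    (hψ1 : ψ 1 = S * Real.sin b) (hψ1' : ψ' 1 - lam * (M / 2) * ψ 1 = K * (S * Real.cos b))
    (h : IsPairSol α₁ ρ₁ q₁ α₂ ρ₂ q₂ M lam y p z r) :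
    ∃ c d : ℝ, (∀ t ∈ Icc (0 : ℝ) 1, y t = c * φ t) ∧ (∀ t ∈ Icc (0 : ℝ) 1, z t = d * ψ t) ∧
      c * R * Real.sin a = d * S * Real.sin b ∧ c * R * Real.cos a = -(d * S * Real.cos b) := by
  have hm1 : (1 : ℝ) ∈ Icc (0 : ℝ) 1 := right_mem_Icc.mpr zero_le_one
  obtain ⟨c, hc⟩ := hφ.exists_eq_const_mul h₁.continuousOn_recip h₁.continuousOn_density
    h₁.continuousOn_potential hφ0 hφ0' h.left h.left_zero
  obtain ⟨d, hd⟩ := hψ.exists_eq_const_mul h₂.continuousOn_recip h₂.continuousOn_density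
    h₂.continuousOn_potential hψ0 hψ0' h.right h.right_zero
  have hcont := h.continuity
  have hbal := h.balance
  rw [(hc 1 hm1).1, (hd 1 hm1).1] at hcont
  rw [(hc 1 hm1).1, (hc 1 hm1).2, (hd 1 hm1).2] at hbal
  refine ⟨c, d, fun t ht => (hc t ht).1, fun t ht => (hd t ht).1, ?_, ?_⟩
  · rw [hφ1, hψ1] at hcont
    linarith
  · refine mul_left_cancel₀ hK.ne' ?_
    linear_combination hbal - c * hφ1' - d * hψ1' + lam * (M / 2) * hcont

/-- The matching conditions tie the two amplitudes together: if one vanishes, so does the other. -/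
theorem eq_zero_of_polar_match {x w a b : ℝ} (hs : x * Real.sin a = w * Real.sin b)
    (hc : x * Real.cos a = -(w * Real.cos b)) (hx : x = 0) : w = 0 := by
  subst hx
  have := Real.sin_sq_add_cos_sq b
  have h2 : w ^ 2 = 0 := by
    linear_combination (-w ^ 2) * this - (w * Real.sin b) * hs + (w * Real.cos b) * hc
  exact pow_eq_zero_iff two_ne_zero |>.mp h2

theorem mem_pairSpectrum_iff (h₁ : IsUnitRod α₁ ρ₁ q₁) (h₂ : IsUnitRod α₂ ρ₂ q₂) {K lam : ℝ}
    (hK : 0 < K) {Θ₁ Θ₂ : ℝ → ℝ} (hΘ₁ : IsPhase α₁ ρ₁ q₁ (M / 2) K Θ₁)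
    (hΘ₂ : IsPhase α₂ ρ₂ q₂ (M / 2) K Θ₂) :
    lam ∈ pairSpectrum α₁ ρ₁ q₁ α₂ ρ₂ q₂ M ↔ Real.sin (Θ₁ lam + Θ₂ lam) = 0 := by
  obtain ⟨R, φ, φ', hR, hφ, hφ0, hφ0', hφ1, hφ1'⟩ := hΘ₁.polar lam
  obtain ⟨S, ψ, ψ', hS, hψ, hψ0, hψ0', hψ1, hψ1'⟩ := hΘ₂.polar lam
  constructor
  · rintro ⟨y, p, z, r, h, hne⟩
    obtain ⟨c, d, hy, hz, hsin, hcos⟩ := h.exists_coords h₁ h₂ hK hφ hφ0 hφ0' hφ1 hφ1'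
      hψ hψ0 hψ0' hψ1 hψ1'
    have e1 : c * R * Real.sin (Θ₁ lam + Θ₂ lam) = 0 := by
      rw [Real.sin_add]
      linear_combination Real.cos (Θ₂ lam) * hsin + Real.sin (Θ₂ lam) * hcos
    rcases mul_eq_zero.mp e1 with hx | hx
    · exfalso
      have hd := eq_zero_of_polar_match hsin hcos hx
      have hc0 := (mul_eq_zero.mp hx).resolve_right hR.ne'
      have hd0 := (mul_eq_zero.mp hd).resolve_right hS.ne'
      rcases hne with ⟨t, ht, hn⟩ | ⟨t, ht, hn⟩
      · exact hn (by rw [hy t ht, hc0, zero_mul])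
      · exact hn (by rw [hz t ht, hd0, zero_mul])
    · exact hx
  · intro hsin
    set s := -Real.cos (Θ₁ lam + Θ₂ lam) with hs
    have hm1 : (1 : ℝ) ∈ Icc (0 : ℝ) 1 := right_mem_Icc.mpr zero_le_one
    have e1 : Real.sin (Θ₁ lam) = s * Real.sin (Θ₂ lam) := by
      have : Real.sin (Θ₁ lam) = Real.sin (Θ₁ lam + Θ₂ lam - Θ₂ lam) := by rw [add_sub_cancel_right]
      rw [this, Real.sin_sub, hsin, hs]; ring
    have e2 : Real.cos (Θ₁ lam) = -(s * Real.cos (Θ₂ lam)) := by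
      have : Real.cos (Θ₁ lam) = Real.cos (Θ₁ lam + Θ₂ lam - Θ₂ lam) := by rw [add_sub_cancel_right]
      rw [this, Real.cos_sub, hsin, hs]; ring
    refine ⟨_, _, _, _, ⟨hφ.const_mul R⁻¹, hψ.const_mul (s * S⁻¹), by simp [hφ0], by simp [hψ0],
      ?_, ?_⟩, Or.inl ?_⟩
    · rw [hφ1, hψ1]
      field_simp
      exact e1
    · have f1 : R⁻¹ * φ 1 = Real.sin (Θ₁ lam) := by rw [hφ1]; field_simp
      have f2 : R⁻¹ * φ' 1 = lam * (M / 2) * Real.sin (Θ₁ lam) + K * Real.cos (Θ₁ lam) := by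
        rw [← f1]
        have := hφ1'
        field_simp at this ⊢
        linear_combination this
      have f3 : s * S⁻¹ * ψ' 1 =
          lam * (M / 2) * (s * Real.sin (Θ₂ lam)) + K * (s * Real.cos (Θ₂ lam)) := by
        have g : ψ' 1 = S * (lam * (M / 2) * Real.sin (Θ₂ lam) + K * Real.cos (Θ₂ lam)) := by
          rw [hψ1] at hψ1'
          linear_combination hψ1'
        rw [g]
        field_simp
      rw [f1, f2, f3]
      linear_combination K * e2 - lam * (M / 2) * e1
    · by_contra! hzero
      have hφz : ∀ t ∈ Icc (0 : ℝ) 1, φ t = 0 := fun t ht =>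
        (mul_eq_zero.mp (hzero t ht)).resolve_left (inv_ne_zero hR.ne')
      exact hφ0' (hφ.snd_eq_zero h₁.recip_pos hφz 0 (left_mem_Icc.mpr zero_le_one))

/-- The solutions at a given parameter form at most a line: along each rod they are multiples of one
fundamental solution, and the two amplitudes determine each other. -/
theorem IsPairSol.exists_eq_const_mul (h₁ : IsUnitRod α₁ ρ₁ q₁) (h₂ : IsUnitRod α₂ ρ₂ q₂)
    (hM : 0 < M) {lam : ℝ} {y p z r y' p' z' r' : ℝ → ℝ}
    (h : IsPairSol α₁ ρ₁ q₁ α₂ ρ₂ q₂ M lam y p z r)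
    (hne : (∃ t ∈ Icc (0 : ℝ) 1, y t ≠ 0) ∨ ∃ t ∈ Icc (0 : ℝ) 1, z t ≠ 0)
    (h' : IsPairSol α₁ ρ₁ q₁ α₂ ρ₂ q₂ M lam y' p' z' r') :
    ∃ k : ℝ, (∀ t ∈ Icc (0 : ℝ) 1, y' t = k * y t) ∧ ∀ t ∈ Icc (0 : ℝ) 1, z' t = k * z t := by
  obtain ⟨Θ₁, hΘ₁⟩ := h₁.exists_isPhase (half_pos hM).le one_pos
  obtain ⟨Θ₂, hΘ₂⟩ := h₂.exists_isPhase (half_pos hM).le one_pos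
  obtain ⟨R, φ, φ', hR, hφ, hφ0, hφ0', hφ1, hφ1'⟩ := hΘ₁.polar lam
  obtain ⟨S, ψ, ψ', hS, hψ, hψ0, hψ0', hψ1, hψ1'⟩ := hΘ₂.polar lam
  obtain ⟨c, d, hy, hz, hsin, hcos⟩ := h.exists_coords h₁ h₂ one_pos hφ hφ0 hφ0' hφ1 hφ1'
    hψ hψ0 hψ0' hψ1 hψ1'
  obtain ⟨c', d', hy', hz', hsin', hcos'⟩ := h'.exists_coords h₁ h₂ one_pos hφ hφ0 hφ0' hφ1 hφ1'
    hψ hψ0 hψ0' hψ1 hψ1'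
  have hc : c ≠ 0 := fun hc => by
    have hd := (mul_eq_zero.mp
      (eq_zero_of_polar_match hsin hcos (by rw [hc, zero_mul]))).resolve_right hS.ne'
    rcases hne with ⟨t, ht, hn⟩ | ⟨t, ht, hn⟩
    · exact hn (by rw [hy t ht, hc, zero_mul])
    · exact hn (by rw [hz t ht, hd, zero_mul])
  -- subtracting the multiple of the first solution that removes the left coefficient
  have hd' : d' - c' / c * d = 0 := by
    have hzero := eq_zero_of_polar_match (x := (c' - c' / c * c) * R) (w := (d' - c' / c * d) * S)
      (a := Θ₁ lam) (b := Θ₂ lam) (by linear_combination hsin' - c' / c * hsin)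
      (by linear_combination hcos' - c' / c * hcos) (by rw [div_mul_cancel₀ _ hc]; ring)
    exact (mul_eq_zero.mp hzero).resolve_right hS.ne'
  refine ⟨c' / c, fun t ht => ?_, fun t ht => ?_⟩
  · rw [hy' t ht, hy t ht, ← mul_assoc, div_mul_cancel₀ _ hc]
  · rw [hz' t ht, hz t ht, sub_eq_zero.mp hd', mul_assoc]

/-- For `lam ≤ 0` the product `y p` is nondecreasing, because its derivative
`α p² + (q - lam ρ) y²` is nonnegative; so it is nonnegative at `1`, and it vanishes there only for
the zero solution. -/
theorem IsSol.mul_nonneg_of_nonpos {α ρ q y p : ℝ → ℝ} {lam : ℝ} (hr : IsUnitRod α ρ q)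
    (h : IsSol α ρ q lam y p) (hlam : lam ≤ 0) (hy : y 0 = 0) :
    0 ≤ y 1 * p 1 ∧ (y 1 * p 1 = 0 → ∀ t ∈ Icc (0 : ℝ) 1, y t = 0) := by
  have hm0 : (0 : ℝ) ∈ Icc (0 : ℝ) 1 := left_mem_Icc.mpr zero_le_one
  have hm1 : (1 : ℝ) ∈ Icc (0 : ℝ) 1 := right_mem_Icc.mpr zero_le_one
  have hd : ∀ t ∈ Icc (0 : ℝ) 1, HasDerivWithinAt (fun t => y t * p t)
      (α t * p t ^ 2 + (q t - lam * ρ t) * y t ^ 2) (Icc 0 1) t := fun t ht =>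
    ((h t ht).1.mul (h t ht).2).congr_deriv (by ring)
  have hpos : ∀ t ∈ Icc (0 : ℝ) 1, 0 < q t - lam * ρ t := fun t ht => by
    have := hr.potential_pos t ht
    have := mul_nonpos_of_nonpos_of_nonneg hlam (hr.density_pos t ht).le
    linarith
  have hmono : MonotoneOn (fun t => y t * p t) (Icc 0 1) :=
    monotoneOn_unit_of_hasDerivWithinAt hd fun t ht => by
      have := hr.recip_pos t ht
      have := hpos t ht
      positivity
  refine ⟨by simpa [hy] using hmono hm0 hm1 zero_le_one, fun h1 t ht => ?_⟩
  have hz : ∀ s ∈ Icc (0 : ℝ) 1, y s * p s = 0 := fun s hs =>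
    le_antisymm ((hmono hs hm1 hs.2).trans_eq h1)
      (le_of_eq_of_le (by simp [hy]) (hmono hm0 hs hs.1))
  have h0 := hasDerivWithinAt_unit_unique ht (hd t ht)
    ((hasDerivWithinAt_const t (Icc (0 : ℝ) 1) (0 : ℝ)).congr hz (hz t ht))
  have hα := hr.recip_pos t ht
  have hq := hpos t ht
  have h2 : (q t - lam * ρ t) * y t ^ 2 = 0 := by
    have : 0 ≤ α t * p t ^ 2 := by positivity
    have : 0 ≤ (q t - lam * ρ t) * y t ^ 2 := by positivity
    linarith
  exact pow_eq_zero_iff two_ne_zero |>.mp ((mul_eq_zero.mp h2).resolve_left hq.ne')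

theorem pos_of_mem_pairSpectrum (h₁ : IsUnitRod α₁ ρ₁ q₁) (h₂ : IsUnitRod α₂ ρ₂ q₂)
    (hM : 0 < M) {lam : ℝ} (h : lam ∈ pairSpectrum α₁ ρ₁ q₁ α₂ ρ₂ q₂ M) : 0 < lam := by
  by_contra! hlam
  obtain ⟨y, p, z, r, hs, hne⟩ := h
  obtain ⟨a, a'⟩ := hs.left.mul_nonneg_of_nonpos h₁ hlam hs.left_zero
  obtain ⟨b, b'⟩ := hs.right.mul_nonneg_of_nonpos h₂ hlam hs.right_zero
  have hsum : y 1 * p 1 + z 1 * r 1 = lam * (M * y 1 ^ 2) := by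
    rw [← hs.continuity]
    linear_combination y 1 * hs.balance
  have hle : lam * (M * y 1 ^ 2) ≤ 0 := mul_nonpos_of_nonpos_of_nonneg hlam (by positivity)
  rcases hne with ⟨t, ht, hn⟩ | ⟨t, ht, hn⟩
  · exact hn (a' (by linarith) t ht)
  · exact hn (b' (by linarith) t ht)

/-- Between two points of the spectrum the sum of the two phases grows by at least `π`, so one of
them grows by `π / 2`; by the uniform Lipschitz bound this takes a fixed amount of `lam`. -/
theorem exists_gap_pairSpectrum (h₁ : IsUnitRod α₁ ρ₁ q₁) (h₂ : IsUnitRod α₂ ρ₂ q₂)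
    (hM : 0 < M) : ∃ δ : ℝ, 0 < δ ∧ ∀ lam ∈ pairSpectrum α₁ ρ₁ q₁ α₂ ρ₂ q₂ M,
      ∀ mu ∈ pairSpectrum α₁ ρ₁ q₁ α₂ ρ₂ q₂ M, lam < mu → δ ≤ mu - lam := by
  obtain ⟨C₁, hC₁, hL₁⟩ := h₁.exists_phase_lipschitz (half_pos hM).le
  obtain ⟨C₂, hC₂, hL₂⟩ := h₂.exists_phase_lipschitz (half_pos hM).le
  refine ⟨1 / (1 + C₁ + C₂), by positivity, fun lam hlam mu hmu hlt => ?_⟩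
  by_contra! hgap
  have hC : 0 < 1 + C₁ + C₂ := by positivity
  rw [lt_div_iff₀ hC] at hgap
  have hd : 0 < mu - lam := sub_pos.mpr hlt
  have hmu1 : mu ≤ lam + 1 := by nlinarith
  have hlam0 := pos_of_mem_pairSpectrum h₁ h₂ hM hlam
  have hK0 : 0 < lam + 1 := by linarith
  obtain ⟨Θ₁, hΘ₁⟩ := h₁.exists_isPhase (half_pos hM).le hK0
  obtain ⟨Θ₂, hΘ₂⟩ := h₂.exists_isPhase (half_pos hM).le hK0
  rw [mem_pairSpectrum_iff h₁ h₂ hK0 hΘ₁ hΘ₂, Real.sin_eq_zero_iff] at hlam hmu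
  obtain ⟨j, hj⟩ := hlam
  obtain ⟨k, hk⟩ := hmu
  have hm₁ := hΘ₁.strictMono hlt
  have hm₂ := hΘ₂.strictMono hlt
  have hπ := Real.pi_pos
  have hjk : (j : ℝ) + 1 ≤ k := by
    have : (j : ℝ) < k := by
      refine lt_of_mul_lt_mul_right (?_ : (j : ℝ) * Real.pi < k * Real.pi) hπ.le
      linarith
    exact_mod_cast this
  have hπ' : Real.pi ≤ (Θ₁ mu - Θ₁ lam) + (Θ₂ mu - Θ₂ lam) := by
    nlinarith
  -- a phase growing by `π / 2` contradicts the Lipschitz bound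
  have key : ∀ (C : ℝ) (Θ : ℝ → ℝ), C ≤ 1 + C₁ + C₂ → Continuous Θ →
      (∀ nu, nu ∈ Icc lam mu → |Real.sin (Θ nu - Θ lam)| ≤ C * |nu - lam|) →
      Θ mu - Θ lam < Real.pi / 2 := by
    intro C Θ hCle hcont hLip
    by_contra! hge
    obtain ⟨nu, hnu, hval⟩ := intermediate_value_Icc hlt.le hcont.continuousOn
      (⟨by linarith, by linarith⟩ : Θ lam + Real.pi / 2 ∈ Icc (Θ lam) (Θ mu))
    have h1 := hLip nu hnu
    rw [hval, add_sub_cancel_left, Real.sin_pi_div_two, abs_one,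
      abs_of_nonneg (sub_nonneg.mpr hnu.1)] at h1
    have h2 : C * (nu - lam) ≤ (1 + C₁ + C₂) * (mu - lam) :=
      mul_le_mul hCle (by linarith [hnu.2]) (by linarith [hnu.1]) hC.le
    linarith
  have hmem : ∀ nu, nu ∈ Icc lam mu → nu ∈ Icc (lam + 1 - 1) (lam + 1) := fun nu hnu =>
    ⟨by linarith [hnu.1], by linarith [hnu.2]⟩
  have hl := hmem lam (left_mem_Icc.mpr hlt.le)
  have k₁ := key C₁ Θ₁ (by linarith) hΘ₁.continuous fun nu hnu =>
    hL₁ (lam + 1) lam nu (by linarith) hl (hmem nu hnu) Θ₁ hΘ₁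
  have k₂ := key C₂ Θ₂ (by linarith) hΘ₂.continuous fun nu hnu =>
    hL₂ (lam + 1) lam nu (by linarith) hl (hmem nu hnu) Θ₂ hΘ₂
  linarith

/-- At scale `K` the phases grow from at most `π / 2` at `lam = 0` to order `K` at `lam = K²`. -/
theorem infinite_pairSpectrum (h₁ : IsUnitRod α₁ ρ₁ q₁) (h₂ : IsUnitRod α₂ ρ₂ q₂)
    (hM : 0 < M) : (pairSpectrum α₁ ρ₁ q₁ α₂ ρ₂ q₂ M).Infinite := by
  intro hfin
  have hπ := Real.pi_pos
  obtain ⟨N, hN⟩ : ∃ N, N = hfin.toFinset.card := ⟨_, rfl⟩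
  have hrod : ∀ {α ρ q : ℝ → ℝ}, IsUnitRod α ρ q → ∃ K₀ : ℝ, ∀ K, K₀ ≤ K → 0 < K →
      ∀ Θ, IsPhase α ρ q (M / 2) K Θ → (N + 3) * Real.pi ≤ Θ (K ^ 2) := by
    intro α ρ q h
    obtain ⟨a, A, ha, -, hα⟩ := exists_pos_bounds_of_continuousOn h.continuousOn_recip h.recip_pos
    obtain ⟨b, B, hb, -, hρ⟩ := exists_pos_bounds_of_continuousOn h.continuousOn_density
      h.density_pos
    obtain ⟨q₀, Q, -, hQ, hq⟩ := exists_pos_bounds_of_continuousOn h.continuousOn_potential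
      h.potential_pos
    refine ⟨max 1 (max ((N + 3) * Real.pi / a) (((N + 3) * Real.pi + Q) / b)),
      fun K hK hK0 Θ hΘ => hΘ.le_apply _ _ (sq_nonneg K) (fun t ht => ?_) fun t ht => ?_⟩
    · have : (N + 3) * Real.pi / a ≤ K := (le_max_left _ _).trans ((le_max_right _ _).trans hK)
      rw [div_le_iff₀ ha] at this
      exact this.trans (by gcongr; exact (hα t ht).1)
    · have hK1 : 1 ≤ K := (le_max_left _ _).trans hK
      have : ((N + 3) * Real.pi + Q) / b ≤ K :=
        (le_max_right _ _).trans ((le_max_right _ _).trans hK)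
      rw [div_le_iff₀ hb] at this
      rw [le_div_iff₀ hK0]
      have e1 : ((N + 3) * Real.pi + Q) * K ≤ K * b * K := by gcongr
      have e2 : K ^ 2 * b ≤ K ^ 2 * ρ t := by gcongr; exact (hρ t ht).1
      have e3 : q t ≤ Q * K := (hq t ht).2.trans (le_mul_of_one_le_right hQ.le hK1)
      linarith
  obtain ⟨K₁, hK₁⟩ := hrod h₁
  obtain ⟨K₂, hK₂⟩ := hrod h₂
  set K := max 1 (max K₁ K₂) with hKdef
  have hK0 : 0 < K := lt_of_lt_of_le one_pos (le_max_left _ _)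
  obtain ⟨Θ₁, hΘ₁⟩ := h₁.exists_isPhase (half_pos hM).le hK0
  obtain ⟨Θ₂, hΘ₂⟩ := h₂.exists_isPhase (half_pos hM).le hK0
  have l₁ := hK₁ K ((le_max_left _ _).trans (le_max_right _ _)) hK0 Θ₁ hΘ₁
  have l₂ := hK₂ K ((le_max_right _ _).trans (le_max_right _ _)) hK0 Θ₂ hΘ₂
  have z₁ := hΘ₁.zero_le
  have z₂ := hΘ₂.zero_le
  have hex : ∀ j : Fin (N + 1), ∃ lam ∈ Icc (0 : ℝ) (K ^ 2),
      Θ₁ lam + Θ₂ lam = ((j : ℕ) + 1 : ℝ) * Real.pi := by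
    intro j
    have hj : ((j : ℕ) : ℝ) ≤ N := by exact_mod_cast Nat.lt_succ_iff.mp j.2
    have hj0 : (0 : ℝ) ≤ ((j : ℕ) : ℝ) := Nat.cast_nonneg _
    exact intermediate_value_Icc (sq_nonneg K)
      (hΘ₁.continuous.add hΘ₂.continuous).continuousOn
      ⟨by simp only [Pi.add_apply]; nlinarith, by simp only [Pi.add_apply]; nlinarith⟩
  choose f hf hf' using hex
  have hinj : Function.Injective f := by
    intro i j hij
    have h1 := hf' i
    rw [hij, hf' j] at h1
    have h2 : ((j : ℕ) : ℝ) = ((i : ℕ) : ℝ) := by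
      have := mul_right_cancel₀ hπ.ne' h1
      linarith
    exact Fin.ext (by exact_mod_cast h2.symm)
  have hmem : ∀ j, f j ∈ hfin.toFinset := fun j => by
    rw [Set.Finite.mem_toFinset, mem_pairSpectrum_iff h₁ h₂ hK0 hΘ₁ hΘ₂, hf' j]
    exact_mod_cast Real.sin_nat_mul_pi ((j : ℕ) + 1)
  have hcard := Finset.card_le_card_of_injOn (s := Finset.univ) f (fun j _ => hmem j) hinj.injOn
  rw [Finset.card_univ, Fintype.card_fin, ← hN] at hcard
  omega

end Pair

/-! ### Enumeration of a separated set -/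

/-- An infinite set of positive reals whose points are `δ`-separated is the range of a strictly
increasing sequence. -/
theorem exists_strictMono_range_eq {S : Set ℝ} (hinf : S.Infinite) (hpos : ∀ x ∈ S, 0 < x) {δ : ℝ}
    (hδ : 0 < δ) (hgap : ∀ x ∈ S, ∀ y ∈ S, x < y → δ ≤ y - x) :
    ∃ f : ℕ → ℝ, StrictMono f ∧ range f = S := by
  -- `x ↦ ⌊x / δ⌋₊` is strictly increasing on `S`
  have hmono : StrictMonoOn (fun x : ℝ => ⌊x / δ⌋₊) S := by
    intro x hx y hy hxy
    have h1 : x / δ + 1 ≤ y / δ := by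
      rw [div_add_one hδ.ne']
      gcongr
      linarith [hgap x hx y hy hxy]
    calc ⌊x / δ⌋₊ < ⌊x / δ⌋₊ + 1 := Nat.lt_succ_self _
      _ = ⌊x / δ + 1⌋₊ := (Nat.floor_add_one (div_nonneg (hpos x hx).le hδ.le)).symm
      _ ≤ ⌊y / δ⌋₊ := Nat.floor_le_floor h1
  set T : Set ℕ := (fun x : ℝ => ⌊x / δ⌋₊) '' S with hT
  have hTinf : T.Infinite := hinf.image hmono.injOn
  choose g hgS hg using fun n : T => (n.2 : ∃ x ∈ S, ⌊x / δ⌋₊ = (n : ℕ))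
  have hgmono : StrictMono g := by
    intro m n hmn
    rw [← hmono.lt_iff_lt (hgS m) (hgS n)]
    simp only [hg]
    exact hmn
  have : Infinite T := hTinf.to_subtype
  refine ⟨fun n => g (Nat.Subtype.orderIsoOfNat T n),
    hgmono.comp (Nat.Subtype.orderIsoOfNat T).strictMono, Subset.antisymm ?_ fun x hx => ?_⟩
  · rintro _ ⟨n, rfl⟩
    exact hgS _
  · refine ⟨(Nat.Subtype.orderIsoOfNat T).symm ⟨_, mem_image_of_mem _ hx⟩, ?_⟩
    simp only [OrderIso.apply_symm_apply]
    exact hmono.injOn (hgS _) hx (hg _)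

/-! ### Sobolev solutions and classical solutions -/

theorem absolutelyContinuousOnInterval_of_hasDerivWithinAt {a b : ℝ} (hab : a < b) {f f' : ℝ → ℝ}
    (hf : ∀ x ∈ Icc a b, HasDerivWithinAt f (f' x) (Icc a b) x)
    (hf' : ContinuousOn f' (Icc a b)) : AbsolutelyContinuousOnInterval f a b := by
  obtain ⟨C, hC⟩ := isCompact_Icc.exists_bound_of_continuousOn hf'
  have hC0 : 0 ≤ C := (norm_nonneg _).trans (hC a (left_mem_Icc.mpr hab.le))
  have hL : LipschitzOnWith (⟨C, hC0⟩ : NNReal) f (uIcc a b) := by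
    rw [uIcc_of_le hab.le]
    exact (convex_Icc a b).lipschitzOnWith_of_nnnorm_hasDerivWithin_le hf fun x hx => hC x hx
  exact hL.absolutelyContinuousOnInterval

theorem memH1_of_hasDerivWithinAt {a b : ℝ} (hab : a < b) {f f' : ℝ → ℝ}
    (hf : ∀ x ∈ Icc a b, HasDerivWithinAt f (f' x) (Icc a b) x)
    (hf' : ContinuousOn f' (Icc a b)) : MemH1 a b f := by
  refine ⟨absolutelyContinuousOnInterval_of_hasDerivWithinAt hab hf hf', ?_⟩
  obtain ⟨C, hC⟩ := isCompact_Icc.exists_bound_of_continuousOn hf'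
  refine MemLp.of_bound (measurable_deriv f).aestronglyMeasurable C ?_
  filter_upwards [ae_restrict_mem measurableSet_Ioo] with x hx
  rw [((hf x (Ioo_subset_Icc_self hx)).hasDerivAt (Icc_mem_nhds hx.1 hx.2)).deriv]
  exact hC x (Ioo_subset_Icc_self hx)

namespace MemH2

variable {a b : ℝ} {f : ℝ → ℝ}

theorem hasDerivWithinAt (h : MemH2 a b f) {x : ℝ} (hx : x ∈ Icc a b) :
    HasDerivWithinAt f (derivWithin f (Icc a b) x) (Icc a b) x :=
  (h.1 x hx).hasDerivWithinAt

theorem continuousOn_derivWithin (hab : a < b) (h : MemH2 a b f) :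
    ContinuousOn (derivWithin f (Icc a b)) (Icc a b) := by
  have := h.2.1.continuousOn
  rwa [uIcc_of_le hab.le] at this

theorem absolutelyContinuousOnInterval (hab : a < b) (h : MemH2 a b f) :
    AbsolutelyContinuousOnInterval f a b :=
  absolutelyContinuousOnInterval_of_hasDerivWithinAt hab (fun _ hx => h.hasDerivWithinAt hx)
    (h.continuousOn_derivWithin hab)

end MemH2

/-- The flux `σ y'` of an `H²` solution is absolutely continuous with an almost everywhere
derivative that is continuous, hence it is continuously differentiable. -/
theorem SolvesSL.hasDerivWithinAt_flux {a b : ℝ} (hab : a < b) {ρ σ q y : ℝ → ℝ} {lam : ℝ}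
    (hr : IsRod a b ρ σ q) (h : SolvesSL a b ρ σ q lam y) {x : ℝ} (hx : x ∈ Icc a b) :
    HasDerivWithinAt (fun t => σ t * derivWithin y (Icc a b) t) ((q x - lam * ρ x) * y x)
      (Icc a b) x := by
  obtain ⟨hy, hae⟩ := h
  have hg : ContinuousOn (fun t => (q t - lam * ρ t) * y t) (Icc a b) :=
    (hr.continuous_potential.sub (continuousOn_const.mul hr.memH2_density.1.continuousOn)).mul
      hy.1.continuousOn
  have hac : AbsolutelyContinuousOnInterval (fun t => σ t * derivWithin y (Icc a b) t) a b :=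
    (hr.memH2_conductivity.absolutelyContinuousOnInterval hab).mul hy.2.1
  have hprim : ∀ t ∈ Icc a b, σ t * derivWithin y (Icc a b) t
      = σ a * derivWithin y (Icc a b) a + ∫ s in a..t, (q s - lam * ρ s) * y s := by
    intro t ht
    have hsub : uIcc a t ⊆ uIcc a b := by
      rw [uIcc_of_le ht.1, uIcc_of_le hab.le]
      exact Icc_subset_Icc_right ht.2
    have h1 := (hac.mono hsub).integral_deriv_eq_sub
    have h2 : ∫ s in a..t, deriv (fun t => σ t * derivWithin y (Icc a b) t) s
        = ∫ s in a..t, (q s - lam * ρ s) * y s := by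
      refine intervalIntegral.integral_congr_ae ?_
      have hb : ∀ᵐ s : ℝ, s ≠ b := by simp [ae_iff, measure_singleton]
      filter_upwards [(ae_restrict_iff' measurableSet_Ioo).mp hae, hb] with s hs hsb hst
      rw [uIoc_of_le ht.1] at hst
      have := hs ⟨hst.1, lt_of_le_of_ne (hst.2.trans ht.2) hsb⟩
      linarith
    linarith
  exact ((hasDerivWithinAt_integral_of_continuousOn hab.le hg hx).const_add _).congr hprim
    (hprim x hx)

/-- A classical solution of the first-order system is an `H²` solution. -/
theorem solvesSL_of_hasDerivWithinAt {a b : ℝ} (hab : a < b) {ρ σ q y p : ℝ → ℝ} {lam : ℝ}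
    (hr : IsRod a b ρ σ q)
    (hy : ∀ x ∈ Icc a b, HasDerivWithinAt y ((σ x)⁻¹ * p x) (Icc a b) x)
    (hp : ∀ x ∈ Icc a b, HasDerivWithinAt p ((q x - lam * ρ x) * y x) (Icc a b) x) :
    SolvesSL a b ρ σ q lam y ∧ ∀ x ∈ Icc a b, σ x * derivWithin y (Icc a b) x = p x := by
  have hder : ∀ x ∈ Icc a b, derivWithin y (Icc a b) x = (σ x)⁻¹ * p x := fun x hx =>
    (hy x hx).derivWithin (uniqueDiffOn_Icc hab x hx)
  have hflux : ∀ x ∈ Icc a b, σ x * derivWithin y (Icc a b) x = p x := fun x hx => by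
    rw [hder x hx, mul_inv_cancel_left₀ (hr.conductivity_pos x hx).ne']
  have hyc : ContinuousOn y (Icc a b) := fun x hx => (hy x hx).continuousWithinAt
  have hpc : ContinuousOn p (Icc a b) := fun x hx => (hp x hx).continuousWithinAt
  have hσ := hr.memH2_conductivity
  have hσ0 : ∀ x ∈ Icc a b, σ x ≠ 0 := fun x hx => (hr.conductivity_pos x hx).ne'
  refine ⟨⟨⟨fun x hx => (hy x hx).differentiableWithinAt, ?_⟩, ?_⟩, hflux⟩
  · refine memH1_of_hasDerivWithinAt hab
      (f' := fun x => -derivWithin σ (Icc a b) x / σ x ^ 2 * p x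
        + (σ x)⁻¹ * ((q x - lam * ρ x) * y x)) (fun x hx => ?_) ?_
    · exact (((hσ.hasDerivWithinAt hx).inv (hσ0 x hx)).mul (hp x hx)).congr hder (hder x hx)
    · refine ContinuousOn.add (ContinuousOn.mul (ContinuousOn.div
        (hσ.continuousOn_derivWithin hab).neg (hσ.1.continuousOn.pow 2)
          fun x hx => pow_ne_zero 2 (hσ0 x hx)) hpc) (ContinuousOn.mul
        (hσ.1.continuousOn.inv₀ hσ0) (ContinuousOn.mul (hr.continuous_potential.sub
          (continuousOn_const.mul hr.memH2_density.1.continuousOn)) hyc))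
  · filter_upwards [ae_restrict_mem measurableSet_Ioo] with x hx
    have hx' := Ioo_subset_Icc_self hx
    have hnhds := Icc_mem_nhds hx.1 hx.2
    have hd := (((hp x hx').congr hflux (hflux x hx')).hasDerivAt hnhds).deriv
    rw [hd]
    ring

/-! ### Transport to the unit interval -/

/-- Change of variables in a one-sided derivative along an affine map `t ↦ c + s t`. -/
theorem hasDerivWithinAt_comp_affine {f : ℝ → ℝ} {d c s t : ℝ} {I J : Set ℝ}
    (hf : HasDerivWithinAt f d J (c + s * t)) (hmap : MapsTo (fun t => c + s * t) I J) :
    HasDerivWithinAt (fun t => f (c + s * t)) (s * d) I t := by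
  have h1 : HasDerivWithinAt (fun t => c + s * t) s I t :=
    (((hasDerivWithinAt_id t I).const_mul s).const_add c).congr_deriv (mul_one s)
  exact (hf.comp t h1 hmap).congr_deriv (mul_comm d s)

theorem IsRod.isUnitRod_comp {a b c s : ℝ} (hab : a < b) {ρ σ q : ℝ → ℝ}
    (h : IsRod a b ρ σ q) (hmap : MapsTo (fun t => c + s * t) (Icc 0 1) (Icc a b)) :
    IsUnitRod (fun t => (σ (c + s * t))⁻¹) (fun t => ρ (c + s * t)) (fun t => q (c + s * t)) := by
  have hφ : ContinuousOn (fun t => c + s * t) (Icc (0 : ℝ) 1) := by fun_prop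
  have hσ := h.memH2_conductivity
  have hρ := h.memH2_density
  have hσ0 : ∀ t ∈ Icc (0 : ℝ) 1, σ (c + s * t) ≠ 0 := fun t ht =>
    (h.conductivity_pos _ (hmap ht)).ne'
  have dα : ∀ t ∈ Icc (0 : ℝ) 1, HasDerivWithinAt (fun t => (σ (c + s * t))⁻¹)
      (-(s * derivWithin σ (Icc a b) (c + s * t)) / σ (c + s * t) ^ 2) (Icc 0 1) t := fun t ht =>
    (hasDerivWithinAt_comp_affine (hσ.hasDerivWithinAt (hmap ht)) hmap).inv (hσ0 t ht)
  have dρ : ∀ t ∈ Icc (0 : ℝ) 1, HasDerivWithinAt (fun t => ρ (c + s * t))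
      (s * derivWithin ρ (Icc a b) (c + s * t)) (Icc 0 1) t := fun t ht =>
    hasDerivWithinAt_comp_affine (hρ.hasDerivWithinAt (hmap ht)) hmap
  have hu : UniqueDiffOn ℝ (Icc (0 : ℝ) 1) := uniqueDiffOn_Icc zero_lt_one
  refine ⟨fun t ht => (dα t ht).differentiableWithinAt, ?_,
    fun t ht => (dρ t ht).differentiableWithinAt, ?_, h.continuous_potential.comp hφ hmap,
    fun t ht => inv_pos.mpr (h.conductivity_pos _ (hmap ht)),
    fun t ht => h.density_pos _ (hmap ht), fun t ht => h.potential_pos _ (hmap ht)⟩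
  · refine ContinuousOn.congr (ContinuousOn.div (ContinuousOn.neg (continuousOn_const.mul
      ((hσ.continuousOn_derivWithin hab).comp hφ hmap)))
      ((hσ.1.continuousOn.comp hφ hmap).pow 2) fun t ht => pow_ne_zero 2 (hσ0 t ht))
      fun t ht => (dα t ht).derivWithin (hu t ht)
  · exact ContinuousOn.congr (continuousOn_const.mul
      ((hρ.continuousOn_derivWithin hab).comp hφ hmap)) fun t ht => (dρ t ht).derivWithin (hu t ht)

/-- An `H²` solution, read along `t ↦ c + s t` with `s = ±1`, solves the first-order system on the
unit interval; the flux changes sign with the orientation. -/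
theorem SolvesSL.isSol_comp {a b c s : ℝ} (hab : a < b) (hs : s ^ 2 = 1) {ρ σ q y : ℝ → ℝ}
    {lam : ℝ} (hr : IsRod a b ρ σ q)
    (hmap : MapsTo (fun t => c + s * t) (Icc 0 1) (Icc a b)) (h : SolvesSL a b ρ σ q lam y) :
    IsSol (fun t => (σ (c + s * t))⁻¹) (fun t => ρ (c + s * t)) (fun t => q (c + s * t)) lam
      (fun t => y (c + s * t))
      (fun t => s * (σ (c + s * t) * derivWithin y (Icc a b) (c + s * t))) := fun t ht => by
  have hσ := (hr.conductivity_pos _ (hmap ht)).ne'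
  refine ⟨(hasDerivWithinAt_comp_affine (h.1.hasDerivWithinAt (hmap ht)) hmap).congr_deriv ?_,
    ((hasDerivWithinAt_comp_affine (h.hasDerivWithinAt_flux hab hr (hmap ht)) hmap).const_mul
      s).congr_deriv ?_⟩
  · field_simp
  · linear_combination ((q (c + s * t) - lam * ρ (c + s * t)) * y (c + s * t)) * hs

/-- Conversely, a solution of the first-order system on the unit interval, read along the inverse
affine map, is an `H²` solution. -/
theorem IsSol.solvesSL_comp {a b c s : ℝ} (hab : a < b) (hs : s ^ 2 = 1) {ρ σ q y p : ℝ → ℝ}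
    {lam : ℝ} (hr : IsRod a b ρ σ q)
    (hmap : MapsTo (fun x => -(s * c) + s * x) (Icc a b) (Icc 0 1))
    (h : IsSol (fun t => (σ (c + s * t))⁻¹) (fun t => ρ (c + s * t)) (fun t => q (c + s * t)) lam
      y p) :
    SolvesSL a b ρ σ q lam (fun x => y (-(s * c) + s * x)) ∧
      ∀ x ∈ Icc a b, σ x * derivWithin (fun x => y (-(s * c) + s * x)) (Icc a b) x
        = s * p (-(s * c) + s * x) := by
  have hinv : ∀ x, c + s * (-(s * c) + s * x) = x := fun x => by
    linear_combination (x - c) * hs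
  refine solvesSL_of_hasDerivWithinAt (p := fun x => s * p (-(s * c) + s * x)) hab hr
    (fun x hx => ?_) (fun x hx => ?_)
  · refine (hasDerivWithinAt_comp_affine (h _ (hmap hx)).1 hmap).congr_deriv ?_
    beta_reduce
    rw [hinv]
    ring
  · refine ((hasDerivWithinAt_comp_affine (h _ (hmap hx)).2 hmap).const_mul s).congr_deriv ?_
    beta_reduce
    rw [hinv]
    linear_combination ((q x - lam * ρ x) * y (-(s * c) + s * x)) * hs

section PointMass

variable {ρ₁ σ₁ q₁ ρ₂ σ₂ q₂ : ℝ → ℝ} {M lam : ℝ}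

theorem mapsTo_left_rod : MapsTo (fun t : ℝ => -1 + 1 * t) (Icc 0 1) (Icc (-1) 0) :=
  fun t ht => ⟨by linarith [ht.1], by linarith [ht.2]⟩

theorem mapsTo_right_rod : MapsTo (fun t : ℝ => 1 + -1 * t) (Icc 0 1) (Icc 0 1) :=
  fun t ht => ⟨by linarith [ht.2], by linarith [ht.1]⟩

theorem SolvesPointMass.isPairSol (h₁ : IsRod (-1) 0 ρ₁ σ₁ q₁) (h₂ : IsRod 0 1 ρ₂ σ₂ q₂)
    {u v : ℝ → ℝ} (h : SolvesPointMass ρ₁ σ₁ q₁ ρ₂ σ₂ q₂ M lam u v) :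
    IsPairSol (fun t => (σ₁ (-1 + 1 * t))⁻¹) (fun t => ρ₁ (-1 + 1 * t)) (fun t => q₁ (-1 + 1 * t))
      (fun t => (σ₂ (1 + -1 * t))⁻¹) (fun t => ρ₂ (1 + -1 * t)) (fun t => q₂ (1 + -1 * t)) M lam
      (fun t => u (-1 + 1 * t))
      (fun t => 1 * (σ₁ (-1 + 1 * t) * derivWithin u (Icc (-1) 0) (-1 + 1 * t)))
      (fun t => v (1 + -1 * t))
      (fun t => -1 * (σ₂ (1 + -1 * t) * derivWithin v (Icc 0 1) (1 + -1 * t))) where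
  left := h.left.isSol_comp (by norm_num) (by norm_num) h₁ mapsTo_left_rod
  right := h.right.isSol_comp (by norm_num) (by norm_num) h₂ mapsTo_right_rod
  left_zero := by simpa using h.dirichlet_left
  right_zero := by simpa using h.dirichlet_right
  continuity := by simpa using h.continuity
  balance := by
    have := h.mass
    norm_num
    linarith

theorem NonzeroPair.unit {u v : ℝ → ℝ} (h : NonzeroPair u v) :
    (∃ t ∈ Icc (0 : ℝ) 1, u (-1 + 1 * t) ≠ 0) ∨ ∃ t ∈ Icc (0 : ℝ) 1, v (1 + -1 * t) ≠ 0 := by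
  rcases h with ⟨x, hx, hn⟩ | ⟨x, hx, hn⟩
  · refine Or.inl ⟨x + 1, ⟨by linarith [hx.1], by linarith [hx.2]⟩, ?_⟩
    rwa [show -1 + 1 * (x + 1) = x by ring]
  · refine Or.inr ⟨1 - x, ⟨by linarith [hx.2], by linarith [hx.1]⟩, ?_⟩
    rwa [show 1 + -1 * (1 - x) = x by ring]

/-- The eigenvalues are the spectrum of the pair of rods transported to the unit interval. -/
theorem pointMassEigenvalues_eq_pairSpectrum (h₁ : IsRod (-1) 0 ρ₁ σ₁ q₁)
    (h₂ : IsRod 0 1 ρ₂ σ₂ q₂) :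
    pointMassEigenvalues ρ₁ σ₁ q₁ ρ₂ σ₂ q₂ M =
      pairSpectrum (fun t => (σ₁ (-1 + 1 * t))⁻¹) (fun t => ρ₁ (-1 + 1 * t))
        (fun t => q₁ (-1 + 1 * t)) (fun t => (σ₂ (1 + -1 * t))⁻¹) (fun t => ρ₂ (1 + -1 * t))
        (fun t => q₂ (1 + -1 * t)) M := by
  ext lam
  constructor
  · rintro ⟨u, v, h, hne⟩
    exact ⟨_, _, _, _, h.isPairSol h₁ h₂, hne.unit⟩
  · rintro ⟨y, p, z, r, h, hne⟩
    obtain ⟨hu, hu'⟩ := h.left.solvesSL_comp (by norm_num) (by norm_num) h₁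
      fun x hx => ⟨by linarith [hx.1], by linarith [hx.2]⟩
    obtain ⟨hv, hv'⟩ := h.right.solvesSL_comp (by norm_num) (by norm_num) h₂
      fun x hx => ⟨by linarith [hx.2], by linarith [hx.1]⟩
    refine ⟨_, _, ⟨hu, hv, ?_, ?_, ?_, ?_⟩, ?_⟩
    · simpa using h.left_zero
    · simpa using h.right_zero
    · simpa using h.continuity
    · rw [hu' 0 (by norm_num), hv' 0 (by norm_num)]
      have := h.balance
      norm_num
      linarith
    · rcases hne with ⟨t, ht, hn⟩ | ⟨t, ht, hn⟩
      · refine Or.inl ⟨t - 1, ⟨by linarith [ht.1], by linarith [ht.2]⟩, ?_⟩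
        beta_reduce
        rwa [show -(1 * -1) + 1 * (t - 1) = t by ring]
      · refine Or.inr ⟨1 - t, ⟨by linarith [ht.2], by linarith [ht.1]⟩, ?_⟩
        beta_reduce
        rwa [show -(-1 * 1) + -1 * (1 - t) = t by ring]

end PointMass

/-! ### The point-mass problem -/

theorem theorem3p1 (ρ₁ σ₁ q₁ ρ₂ σ₂ q₂ : ℝ → ℝ) (M : ℝ) (hM : 0 < M)
    (h₁ : IsRod (-1) 0 ρ₁ σ₁ q₁) (h₂ : IsRod 0 1 ρ₂ σ₂ q₂) :
    ∃ lam : ℕ → ℝ, StrictMono lam ∧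
      Set.range lam = pointMassEigenvalues ρ₁ σ₁ q₁ ρ₂ σ₂ q₂ M ∧
      (∀ n, IsSimplePointMassEigenvalue ρ₁ σ₁ q₁ ρ₂ σ₂ q₂ M (lam n)) ∧
      ∃ δ₁ : ℝ, 0 < δ₁ ∧ ∀ n, δ₁ ≤ lam (n + 1) - lam n := by
  have r₁ := h₁.isUnitRod_comp (by norm_num) mapsTo_left_rod
  have r₂ := h₂.isUnitRod_comp (by norm_num) mapsTo_right_rod
  have hS := pointMassEigenvalues_eq_pairSpectrum (M := M) h₁ h₂
  obtain ⟨δ, hδ, hgap⟩ := exists_gap_pairSpectrum r₁ r₂ hM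
  obtain ⟨lam, hmono, hrange⟩ := exists_strictMono_range_eq (infinite_pairSpectrum r₁ r₂ hM)
    (fun _ => pos_of_mem_pairSpectrum r₁ r₂ hM) hδ hgap
  rw [← hS] at hrange hgap
  have hmem : ∀ n, lam n ∈ pointMassEigenvalues ρ₁ σ₁ q₁ ρ₂ σ₂ q₂ M := fun n =>
    hrange ▸ mem_range_self n
  refine ⟨lam, hmono, hrange, fun n => ⟨hmem n, fun u v u' v' h hne h' => ?_⟩, δ, hδ, fun n =>
    hgap _ (hmem n) _ (hmem (n + 1)) (hmono n.lt_succ_self)⟩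
  obtain ⟨k, hk, hk'⟩ := (h.isPairSol h₁ h₂).exists_eq_const_mul r₁ r₂ hM hne.unit
    (h'.isPairSol h₁ h₂)
  refine ⟨k, fun x hx => ?_, fun x hx => ?_⟩
  · have := hk (x + 1) ⟨by linarith [hx.1], by linarith [hx.2]⟩
    rwa [show -1 + 1 * (x + 1) = x by ring] at this
  · have := hk' (1 - x) ⟨by linarith [hx.2], by linarith [hx.1]⟩
    rwa [show 1 + -1 * (1 - x) = x by ring] at this
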